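/- Let $n\ge 1$ and let $\rho:\mathbb R^n\to[0,1]$ be smooth with $\rho(\xi)=1$ for $|\xi|\le \sqrt n/2$ and $\rho(\xi)=0$ for $|\xi|\ge\sqrt n$. For $k\in\mathbb Z^n$ put $\sigma_k(\xi)=\rho(\xi-k)\big(\sum_{l\in\mathbb Z^n}\rho(\xi-l)\big)^{-1}$ and $\square_k=\mathscr F^{-1}\sigma_k\mathscr F$. For $s\in\mathbb R$, $1\le p\le\infty$, $1\le q<\infty$ the modulation space $M^s_{p,q}$ is the space of all $u\in\mathscr S'(\mathbb R^n)$ with $$\|u\|_{M^s_{p,q}}=\Big(\sum_{k\in\mathbb Z^n}(1+|k|)^{sq}\|\square_k u\|_{L^p}^q\Big)^{1/q}<\infty ,$$ and, for $1\le r\le\infty$, $l^{s,q}_\square(L^r(\mathbb R,L^p))$ is the space of all time-dependent tempered distributions $u:\mathbb R\to\mathscr S'(\mathbb R^n)$ with $$\|u\|_{l^{s,q}_\square(L^r(\mathbb R,L^p))}=\Big(\sum_{k\in\mathbb Z^n}(1+|k|)^{sq}\|\square_k u\|_{L^r(\mathbb R,L^p)}^q\Big)^{1/q}<\infty ,$$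 where $\square_k$ acts in the space variable and $L^r(\mathbb R,X)$ denotes the Bochner space. Let $P:\mathbb R^n\to\mathbb R$ be measurable and $U(t)=\mathscr F^{-1}e^{itP(\xi)}\mathscr F$, $t\in\mathbb R$, defined on the tempered distributions whose Fourier transform is a function. Let $2\le p<\infty$, $\frac1p+\frac1{p'}=1$, $1\le q<\infty$, $\alpha,\delta\in\mathbb R$ and $0<\mu<1$, and suppose that there is a constant $A$ with $$\|U(t)f\|_{M^{\alpha}_{p,q}}\le A\,(1+|t|)^{-\mu}\,\|f\|_{M^{\alpha+\delta}_{p',q}}\qquad\text{for all } t\in\mathbb R,\ f\in M^{\alpha+\delta}_{p',q}.$$ Let $\gamma=\frac2\mu$, $\frac1\gamma+\frac1{\gamma'}=1$, $s\in\mathbb R$, and $$(\mathcal N f)(t)=\int_0^tU(t-\tau)f(\tau)\,d\tau ,$$ the integral being taken in the weak sense in $\mathscr S'(\mathbb R^n)$. (1) There is a constant $C$ such that for every $f\in l^{s+\delta/2,q}_\square(L^{\gamma'}(\mathbb R,L^{p'}))$ the function $\mathcal Nf$ is well defined and $$\|\mathcal N f\|_{l^{s,q}_\square(L^\infty(\mathbb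 R,L^2))}\le C\,\|f\|_{l^{s+\delta/2,q}_\square(L^{\gamma'}(\mathbb R,L^{p'}))}.$$ (2) If in addition $\gamma'\le q$, there is a constant $C$ such that for every $f\in L^{\gamma'}(\mathbb R,M^{s+\delta/2}_{p',q})$ the function $\mathcal Nf$ is well defined and $$\|\mathcal N f\|_{L^\infty(\mathbb R,M^s_{2,q})}\le C\,\|f\|_{L^{\gamma'}(\mathbb R,M^{s+\delta/2}_{p',q})}.$$ -/

import Mathlib

open MeasureTheory SchwartzMap FourierTransform
open scoped ENNReal NNReal

noncomputable section

namespace ModulationSpace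

/-- The Euclidean space `ℝⁿ`. -/
abbrev Euc (n : ℕ) : Type := EuclideanSpace ℝ (Fin n)

/-- A lattice point `k ∈ ℤⁿ`, seen in `ℝⁿ`. -/
def latticePt {n : ℕ} (k : Fin n → ℤ) : Euc n := WithLp.toLp 2 (fun i => (k i : ℝ))

/-- The functions `ρ` generating the frequency-uniform decomposition: smooth, with values in
`[0,1]`, equal to `1` for `|ξ| ≤ √n / 2` and to `0` for `|ξ| ≥ √n`. -/
structure IsGenerator {n : ℕ} (ρ : Euc n → ℝ) : Prop where
  smooth : ContDiff ℝ (⊤ : ℕ∞) ρ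
  nonneg : ∀ ξ, 0 ≤ ρ ξ
  le_one : ∀ ξ, ρ ξ ≤ 1
  eq_one : ∀ ξ, ‖ξ‖ ≤ √(n : ℝ) / 2 → ρ ξ = 1
  eq_zero : ∀ ξ, √(n : ℝ) ≤ ‖ξ‖ → ρ ξ = 0

/-- `σ_k(ξ) = ρ(ξ - k) / ∑_l ρ(ξ - l)`. For a generator `ρ` the sum is locally finite and
at least `1`. -/
def sigma {n : ℕ} (ρ : Euc n → ℝ) (k : Fin n → ℤ) (ξ : Euc n) : ℝ :=
  ρ (ξ - latticePt k) / ∑' l : Fin n → ℤ, ρ (ξ - latticePt l)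

/-- The frequency-uniform decomposition operator `□_k = 𝓕⁻¹ σ_k 𝓕` on tempered distributions. -/
def box {n : ℕ} (ρ : Euc n → ℝ) (k : Fin n → ℤ) (u : 𝓢'(Euc n, ℂ)) : 𝓢'(Euc n, ℂ) :=
  TemperedDistribution.fourierMultiplierCLM ℂ (fun ξ => (sigma ρ k ξ : ℂ)) u

/-- The `L^p(ℝⁿ)` norm of a tempered distribution; it is `∞` unless the distribution is (given by)
an element of `L^p`, which is then unique. -/
def lebNorm {n : ℕ} (p : ℝ≥0∞) [Fact (1 ≤ p)] (u : 𝓢'(Euc n, ℂ)) : ℝ≥0∞ :=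
  ⨅ (g : Lp ℂ p (volume : Measure (Euc n))) (_ : Lp.toTemperedDistribution g = u), ‖g‖ₑ

/-- The weight `(1 + |k|)^s`. -/
def weight {n : ℕ} (s : ℝ) (k : Fin n → ℤ) : ℝ≥0∞ :=
  ENNReal.ofReal ((1 + ‖latticePt k‖) ^ s)

/-- The norm `‖u‖_{M^s_{p,q}}`, `1 ≤ q < ∞`; a tempered distribution `u` belongs to `M^s_{p,q}`
if and only if it is finite. -/
def modNorm {n : ℕ} (ρ : Euc n → ℝ) (s : ℝ) (p : ℝ≥0∞) [Fact (1 ≤ p)] (q : ℝ)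
    (u : 𝓢'(Euc n, ℂ)) : ℝ≥0∞ :=
  (∑' k : Fin n → ℤ, (weight s k * lebNorm p (box ρ k u)) ^ q) ^ (1 / q)

/-- `u : ℝ → 𝓢'` agrees almost everywhere with a strongly measurable function into `L^p(ℝⁿ)`. -/
def StronglyMeasurableInLp {n : ℕ} (p : ℝ≥0∞) [Fact (1 ≤ p)] (u : ℝ → 𝓢'(Euc n, ℂ)) : Prop :=
  ∃ G : ℝ → Lp ℂ p (volume : Measure (Euc n)), AEStronglyMeasurable G volume ∧
    ∀ᵐ t : ℝ, Lp.toTemperedDistribution (G t) = u t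

open Classical in
/-- The norm of the Bochner space `L^r(ℝ; L^p(ℝⁿ))`, `1 ≤ r ≤ ∞` (`∞` outside of it). -/
def bochnerLebNorm {n : ℕ} (r p : ℝ≥0∞) [Fact (1 ≤ p)] (u : ℝ → 𝓢'(Euc n, ℂ)) : ℝ≥0∞ :=
  if StronglyMeasurableInLp p u then eLpNorm (fun t => lebNorm p (u t)) r volume else ∞

/-- The norm of `l^{s,q}_□(L^r(ℝ; L^p(ℝⁿ)))`, `1 ≤ q < ∞` (`∞` outside of it). The operators `□_k`
act in the space variable. -/
def lBoxNorm {n : ℕ} (ρ : Euc n → ℝ) (s q : ℝ) (r p : ℝ≥0∞) [Fact (1 ≤ p)]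
    (u : ℝ → 𝓢'(Euc n, ℂ)) : ℝ≥0∞ :=
  (∑' k : Fin n → ℤ,
    (weight s k * bochnerLebNorm r p (fun t => box ρ k (u t))) ^ q) ^ (1 / q)

open Classical in
/-- The norm of the Bochner space `L^r(ℝ; M^s_{p,q}(ℝⁿ))`, `1 ≤ q < ∞` (`∞` outside of it).
As `q < ∞`, the isometric embedding `u ↦ ((1 + |k|)^s □_k u)_k` of `M^s_{p,q}` into `ℓ^q(L^p)`
shows that strong measurability may be tested on each `□_k u`. -/
def bochnerModNorm {n : ℕ} (ρ : Euc n → ℝ) (r : ℝ≥0∞) (s : ℝ) (p : ℝ≥0∞) [Fact (1 ≤ p)] (q : ℝ)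
    (u : ℝ → 𝓢'(Euc n, ℂ)) : ℝ≥0∞ :=
  if ∀ k : Fin n → ℤ, StronglyMeasurableInLp p (fun t => box ρ k (u t)) then
    eLpNorm (fun t => modNorm ρ s p q (u t)) r volume
  else ∞

/-- The tempered distribution `u` is given by the function `g`. -/
def IsRepresentedBy {n : ℕ} (u : 𝓢'(Euc n, ℂ)) (g : Euc n → ℂ) : Prop :=
  ∀ φ : 𝓢(Euc n, ℂ), Integrable (fun ξ => φ ξ * g ξ) ∧ u φ = ∫ ξ, φ ξ * g ξ

/-- `v = U(t) u`, where `U(t) = 𝓕⁻¹ e^{itP(ξ)} 𝓕`: the Fourier transform of `u` is a function `g`,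
and the Fourier transform of `v` is the function `e^{itP} g`. -/
def IsPropagated {n : ℕ} (P : Euc n → ℝ) (t : ℝ) (u v : 𝓢'(Euc n, ℂ)) : Prop :=
  ∃ g : Euc n → ℂ, IsRepresentedBy (𝓕 u) g ∧
    IsRepresentedBy (𝓕 v) (fun ξ => Complex.exp (Complex.I * t * P ξ) * g ξ)

/-- `‖U(t) f‖_{M^α_{p,q}} ≲ (1 + |t|)^{-μ} ‖f‖_{M^{α+δ}_{p',q}}` for `t ∈ ℝ`,
`f ∈ M^{α+δ}_{p',q}`. -/
def DispersiveEstimate {n : ℕ} (ρ : Euc n → ℝ) (P : Euc n → ℝ) (p p' : ℝ≥0∞) [Fact (1 ≤ p)]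
    [Fact (1 ≤ p')] (q α δ μ : ℝ) : Prop :=
  ∃ A : ℝ≥0, ∀ (t : ℝ) (f v : 𝓢'(Euc n, ℂ)),
    modNorm ρ (α + δ) p' q f < ∞ → IsPropagated P t f v →
      modNorm ρ α p q v ≤
        A * ENNReal.ofReal ((1 + |t|) ^ (-μ)) * modNorm ρ (α + δ) p' q f

/-- `u = 𝓝 f`, where `(𝓝 f)(t) = ∫_0^t U(t - τ) f(τ) dτ`: for every `t`, the distribution
`w τ = U(t - τ) f(τ)` is defined for almost every `τ` between `0` and `t`, and `u t` is the
(weak) integral of `w`. -/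
def IsDuhamel {n : ℕ} (P : Euc n → ℝ) (f u : ℝ → 𝓢'(Euc n, ℂ)) : Prop :=
  ∀ t : ℝ, ∃ w : ℝ → 𝓢'(Euc n, ℂ),
    (∀ᵐ τ : ℝ, τ ∈ Set.uIoc 0 t → IsPropagated P (t - τ) (f τ) (w τ)) ∧
    ∀ φ : 𝓢(Euc n, ℂ), IntervalIntegrable (fun τ => w τ φ) volume 0 t ∧
      u t φ = ∫ τ in (0 : ℝ)..t, w τ φ

end ModulationSpace

end

noncomputable section

namespace ModulationSpace

/-! ### Fractional integration on the line: the diagonal Hardy-Littlewood-Sobolev inequality -/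

section HardyLittlewoodSobolev

/-! The proof is a `T T*` argument carried out separately on each frequency piece. Fix `k`. By
Young's inequality `□_k f(τ)`, which lies in `L^{p'}` with `1 < p' ≤ 2`, also lies in `L²`, where
`U(t)` is a unitary group. Taking `U(t)` out of the Duhamel integral and expanding the square of the
norm bounds `‖□_k 𝓝f(t)‖²` by the double time integral of `|⟨□_k f(x), U(x - y) □_k f(y)⟩|`, over
all of `ℝ × ℝ` by positivity, hence uniformly in `t` (`enorm_duhamel_sq_le`).

On frequencies near `k` all weights are comparable to powers of `1 + |k|`, so the dispersive
estimate becomes an `L^{p'} → L^p` bound with constant `(1 + |k|)^δ (1 + |t|)^{-μ}`; the order `α`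
cancels (`exists_enorm_inner_prop_le`). What remains is the form with kernel `(1 + |x - y|)^{-μ}`,
controlled by the square of the `L^{γ'}` norm in time, as `γ' = 2 / (2 - μ)`
(`hardy_littlewood_sobolev_diagonal`). The square root turns `δ` into `δ/2`
(`exists_enorm_duhamel_le`). Taking weighted `ℓ^q` norms in `k` gives (1). Part (2) follows from (1)
by Minkowski's inequality, which puts `L^{γ'}(M)` inside `l_□(L^{γ'})` when `γ' ≤ q`, together with
the trivial embedding of `l_□(L^∞)` into `L^∞(M)`.

That `𝓝f` exists needs a separate argument, since `f(τ)` itself need not be in `L²`. The Fourier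
transforms of the pieces, damped by `(1 + |ξ|²)^{-M}` with `M` large, form an absolutely convergent
series in `L²` for almost every `τ`, locally integrable in `τ`. Thus the Fourier transform of `f(τ)`
is a polynomially growing symbol times an `L²` function, and the Duhamel integral is a Bochner
integral of these `L²` functions (`hasSum_toTemperedDistribution`, `exists_isDuhamel`). -/

theorem lintegral_comp_abs_eq (f : ℝ → ℝ≥0∞) :
    ∫⁻ z : ℝ, f |z| = 2 * ∫⁻ z in Set.Ioi 0, f z := by
  have h1 : ∫⁻ z in Set.Ioi (0 : ℝ), f |z| = ∫⁻ z in Set.Ioi 0, f z :=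
    setLIntegral_congr_fun measurableSet_Ioi fun z hz => by
      simp only [abs_of_pos (Set.mem_Ioi.1 hz)]
  have h2 : ∫⁻ z in Set.Iio (0 : ℝ), f |z| = ∫⁻ z in Set.Ioi 0, f z := by
    rw [← h1]
    have h := (Measure.measurePreserving_neg (volume : Measure ℝ)).setLIntegral_comp_preimage_emb
      (MeasurableEquiv.neg ℝ).measurableEmbedding (fun z => f |z|) (Set.Ioi 0)
    simpa using h
  rw [← lintegral_add_compl _ (measurableSet_Ioi (a := (0 : ℝ))), h1, Set.compl_Ioi,
    setLIntegral_congr Iio_ae_eq_Iic.symm, h2, two_mul]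

/-- Near part of the kernel: `|z|^{-μ}` is a majorant, integrable at the origin because `μ < 1`. -/
theorem lintegral_indicator_abs_le_rpow_neg_le {μ R : ℝ} (hμ0 : 0 < μ) (hμ1 : μ < 1) (hR : 0 < R) :
    ∫⁻ z : ℝ, (if |z| ≤ R then ENNReal.ofReal ((1 + |z|) ^ (-μ)) else 0) ≤
      ENNReal.ofReal (2 * R ^ (1 - μ) / (1 - μ)) := by
  rw [lintegral_comp_abs_eq (fun z => if z ≤ R then ENNReal.ofReal ((1 + z) ^ (-μ)) else 0)]
  have h1 : ∫⁻ z in Set.Ioi (0 : ℝ), (if z ≤ R then ENNReal.ofReal ((1 + z) ^ (-μ)) else 0) ≤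
      ∫⁻ z in Set.Ioc 0 R, ENNReal.ofReal (z ^ (-μ)) := by
    rw [← lintegral_indicator measurableSet_Ioi, ← lintegral_indicator measurableSet_Ioc]
    refine lintegral_mono fun z => ?_
    by_cases hz : 0 < z <;> by_cases hz' : z ≤ R <;> simp [Set.indicator, hz, hz']
    exact ENNReal.ofReal_le_ofReal
      (Real.rpow_le_rpow_of_nonpos hz (by linarith) (by linarith))
  have h2 : ∫⁻ z in Set.Ioc 0 R, ENNReal.ofReal (z ^ (-μ)) = ENNReal.ofReal (R ^ (1 - μ) / (1 - μ)) := by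
    rw [← ofReal_integral_eq_lintegral_ofReal, ← intervalIntegral.integral_of_le hR.le,
      integral_rpow (Or.inl (by linarith)), Real.zero_rpow (by linarith), sub_zero]
    · ring_nf
    · exact (intervalIntegral.intervalIntegrable_rpow' (by linarith)).1
    · filter_upwards [ae_restrict_mem measurableSet_Ioc] with z hz
      exact Real.rpow_nonneg hz.1.le _
  calc _ ≤ 2 * ENNReal.ofReal (R ^ (1 - μ) / (1 - μ)) := by rw [← h2]; gcongr
    _ = _ := by
      rw [mul_div_assoc, ENNReal.ofReal_mul (by norm_num)]; simp

/-- Far part of the kernel, measured in the exponent `2 / μ` conjugate to `r = 2 / (2 - μ)`; the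
power of the kernel is then dominated by `|z|^{-2}`. -/
theorem lintegral_indicator_lt_abs_rpow_neg_le {μ R : ℝ} (hμ0 : 0 < μ) (hR : 0 < R) :
    ∫⁻ z : ℝ, (if R < |z| then ENNReal.ofReal ((1 + |z|) ^ (-μ)) else 0) ^ (2 / μ) ≤
      ENNReal.ofReal (2 / R) := by
  rw [lintegral_comp_abs_eq
    (fun z => (if R < z then ENNReal.ofReal ((1 + z) ^ (-μ)) else 0) ^ (2 / μ))]
  have h1 : ∫⁻ z in Set.Ioi (0 : ℝ),
      (if R < z then ENNReal.ofReal ((1 + z) ^ (-μ)) else 0) ^ (2 / μ) ≤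
      ∫⁻ z in Set.Ioi R, ENNReal.ofReal (z ^ (-2 : ℝ)) := by
    rw [← lintegral_indicator measurableSet_Ioi, ← lintegral_indicator measurableSet_Ioi]
    refine lintegral_mono fun z => ?_
    have h2μ : 0 < 2 / μ := by positivity
    by_cases hz' : R < z
    · have hz : 0 < z := hR.trans hz'
      have h1z : 0 ≤ 1 + z := by positivity
      simp only [Set.indicator, Set.mem_Ioi, hz, hz', if_true]
      rw [ENNReal.ofReal_rpow_of_nonneg (Real.rpow_nonneg h1z _) h2μ.le, ← Real.rpow_mul h1z]
      have : -μ * (2 / μ) = -2 := by field_simp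
      rw [this]
      exact ENNReal.ofReal_le_ofReal
        (Real.rpow_le_rpow_of_nonpos hz (by linarith) (by norm_num))
    · simp [Set.indicator, hz', h2μ]
  have h2 : ∫⁻ z in Set.Ioi R, ENNReal.ofReal (z ^ (-2 : ℝ)) = ENNReal.ofReal (1 / R) := by
    rw [← ofReal_integral_eq_lintegral_ofReal, integral_Ioi_rpow_of_lt (by norm_num) hR]
    · norm_num [Real.rpow_neg_one]
    · exact integrableOn_Ioi_rpow_of_lt (by norm_num) hR
    · filter_upwards [ae_restrict_mem measurableSet_Ioi] with z hz
      exact Real.rpow_nonneg (hR.trans hz).le _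
  calc _ ≤ 2 * ENNReal.ofReal (1 / R) := by rw [← h2]; gcongr
    _ = _ := by
      rw [← mul_one_div 2 R, ENNReal.ofReal_mul (by norm_num)]; simp

/-- The part of the fractional integral of `a` at `x` that comes from values below `h = a x`. -/
theorem lintegral_min_mul_rpow_neg_le {μ r : ℝ} (hμ0 : 0 < μ) (hμ1 : μ < 1) (hr : r * (2 - μ) = 2)
    {a : ℝ → ℝ≥0∞} (ha : Measurable a) {A h : ℝ} (hA : 0 < A) (hh : 0 < h)
    (hint : ∫⁻ y, a y ^ r = ENNReal.ofReal A) (x : ℝ) :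
    ∫⁻ y, (if a y ≤ ENNReal.ofReal h then a y else 0) * ENNReal.ofReal ((1 + |x - y|) ^ (-μ)) ≤
      ENNReal.ofReal ((2 / (1 - μ) + 2 ^ (μ / 2)) * A ^ (1 - μ) * h ^ (r - 1)) := by
  have hr0 : 0 < r := by
    by_contra hc
    nlinarith
  have hconj : r.HolderConjugate (2 / μ) := by
    have hr' : r = 2 / (2 - μ) := by field_simp [show (2 - μ) ≠ 0 by linarith]; linarith
    refine Real.holderConjugate_iff.2 ⟨by nlinarith, ?_⟩
    rw [hr']; field_simp; ring
  -- The radius that balances the two parts: the near bound `h R^{1-μ}` and the far Hölder bound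
  -- `A^{1/r} R^{-μ/2}` both become multiples of `A^{1-μ} h^{r-1}`.
  set R : ℝ := A * h ^ (-r) with hRdef
  have hR : 0 < R := by positivity
  set kn : ℝ → ℝ≥0∞ := fun z => if |z| ≤ R then ENNReal.ofReal ((1 + |z|) ^ (-μ)) else 0
  set kf : ℝ → ℝ≥0∞ := fun z => if R < |z| then ENNReal.ofReal ((1 + |z|) ^ (-μ)) else 0
  have hkn : Measurable kn := Measurable.ite
    (measurableSet_le measurable_norm measurable_const) (by fun_prop) measurable_const
  have hkf : Measurable kf := Measurable.ite
    (measurableSet_lt measurable_const measurable_norm) (by fun_prop) measurable_const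
  have hle : ∀ y, (if a y ≤ ENNReal.ofReal h then a y else 0) *
      ENNReal.ofReal ((1 + |x - y|) ^ (-μ)) ≤ ENNReal.ofReal h * kn (x - y) + a y * kf (x - y) := by
    intro y
    by_cases h1 : |x - y| ≤ R
    · refine le_trans ?_ le_self_add
      simp only [kn, h1, if_true]
      gcongr
      split_ifs with h2
      exacts [h2, zero_le]
    · refine le_trans ?_ le_add_self
      simp only [kf, not_le.1 h1, if_true]
      gcongr
      split_ifs with h2
      exacts [le_rfl, zero_le]
  have hn : ∫⁻ y, kn (x - y) ≤ ENNReal.ofReal (2 * R ^ (1 - μ) / (1 - μ)) := by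
    rw [lintegral_sub_left_eq_self kn x]
    exact lintegral_indicator_abs_le_rpow_neg_le hμ0 hμ1 hR
  have hf : ∫⁻ y, kf (x - y) ^ (2 / μ) ≤ ENNReal.ofReal (2 / R) := by
    rw [lintegral_sub_left_eq_self (fun z => kf z ^ (2 / μ)) x]
    exact lintegral_indicator_lt_abs_rpow_neg_le hμ0 hR
  have hfar : ∫⁻ y, a y * kf (x - y) ≤
      ENNReal.ofReal A ^ (1 / r) * ENNReal.ofReal (2 / R) ^ (1 / (2 / μ)) := by
    refine (ENNReal.lintegral_mul_le_Lp_mul_Lq volume hconj ha.aemeasurable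
      (hkf.comp (measurable_const.sub measurable_id)).aemeasurable).trans ?_
    rw [hint]
    gcongr
    exact hf
  calc _ ≤ ∫⁻ y, (ENNReal.ofReal h * kn (x - y) + a y * kf (x - y)) := lintegral_mono hle
    _ = (ENNReal.ofReal h * ∫⁻ y, kn (x - y)) + ∫⁻ y, a y * kf (x - y) := by
      have hkx : Measurable fun y => kn (x - y) := hkn.comp (measurable_const.sub measurable_id)
      rw [lintegral_add_left (hkx.const_mul _), lintegral_const_mul _ hkx]
    _ ≤ ENNReal.ofReal h * ENNReal.ofReal (2 * R ^ (1 - μ) / (1 - μ)) +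
        ENNReal.ofReal A ^ (1 / r) * ENNReal.ofReal (2 / R) ^ (1 / (2 / μ)) := by gcongr
    _ = ENNReal.ofReal (h * (2 * R ^ (1 - μ) / (1 - μ)) +
        A ^ (1 / r) * (2 / R) ^ (1 / (2 / μ))) := by
      have h1μ : 0 < 1 - μ := by linarith
      rw [ENNReal.ofReal_rpow_of_pos hA, ENNReal.ofReal_rpow_of_pos (by positivity),
        ← ENNReal.ofReal_mul hh.le, ← ENNReal.ofReal_mul (by positivity),
        ← ENNReal.ofReal_add (by positivity) (by positivity)]
    _ = _ := by
      congr 1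
      rw [Real.div_rpow (by norm_num) hR.le, hRdef]
      -- With `h` and `A` written as exponentials, identities between real powers become identities
      -- between exponents, which follow from `hr`.
      obtain ⟨u, rfl⟩ : ∃ u, h = Real.exp u := ⟨_, (Real.exp_log hh).symm⟩
      obtain ⟨v, rfl⟩ : ∃ v, A = Real.exp v := ⟨_, (Real.exp_log hA).symm⟩
      have e1 : Real.exp u * (2 * (Real.exp v * Real.exp u ^ (-r)) ^ (1 - μ) / (1 - μ)) =
          2 / (1 - μ) * (Real.exp v ^ (1 - μ) * Real.exp u ^ (r - 1)) := by
        have : Real.exp u * (Real.exp v * Real.exp u ^ (-r)) ^ (1 - μ) =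
            Real.exp v ^ (1 - μ) * Real.exp u ^ (r - 1) := by
          simp only [← Real.exp_mul, ← Real.exp_add]
          congr 1
          linear_combination -u * hr
        rw [← this]; ring
      have e2 : Real.exp v ^ (1 / r) * (2 ^ (1 / (2 / μ)) /
            (Real.exp v * Real.exp u ^ (-r)) ^ (1 / (2 / μ))) =
          2 ^ (μ / 2) * (Real.exp v ^ (1 - μ) * Real.exp u ^ (r - 1)) := by
        have hi : 1 / (2 / μ) = μ / 2 := by field_simp
        have : Real.exp v ^ (1 / r) / (Real.exp v * Real.exp u ^ (-r)) ^ (μ / 2) =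
            Real.exp v ^ (1 - μ) * Real.exp u ^ (r - 1) := by
          simp only [← Real.exp_mul, ← Real.exp_add, ← Real.exp_sub]
          congr 1
          have : 1 / r = 1 - μ / 2 := by field_simp; linarith
          rw [this]
          linear_combination -u / 2 * hr
        rw [← this, hi]; ring
      rw [e1, e2]; ring

/-- The diagonal case of the Hardy-Littlewood-Sobolev inequality on the line, for the
inhomogeneous kernel `(1 + |x - y|)^{-μ}`. -/
theorem hardy_littlewood_sobolev_diagonal {μ r : ℝ} (hμ0 : 0 < μ) (hμ1 : μ < 1)
    (hr : r * (2 - μ) = 2) :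
    ∃ C : ℝ≥0, ∀ a : ℝ → ℝ≥0∞, AEMeasurable a →
      ∫⁻ x, ∫⁻ y, a x * a y * ENNReal.ofReal ((1 + |x - y|) ^ (-μ)) ≤
        C * ((∫⁻ x, a x ^ r) ^ (1 / r)) ^ 2 := by
  have hr0 : 0 < r := by
    by_contra hc
    nlinarith
  set c : ℝ := 2 / (1 - μ) + 2 ^ (μ / 2) with hc
  have h1μ : 0 < 1 - μ := by linarith
  have hc0 : 0 < c := by positivity
  refine ⟨(2 * c).toNNReal, fun a' ha' => ?_⟩
  wlog hm : Measurable a' generalizing a'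
  · have := this _ ha'.measurable_mk.aemeasurable ha'.measurable_mk
    have e1 : ∫⁻ x, ha'.mk a' x ^ r = ∫⁻ x, a' x ^ r :=
      lintegral_congr_ae (ha'.ae_eq_mk.mono fun x hx => by simp only [← hx])
    rw [e1] at this
    refine le_trans (le_of_eq ?_) this
    refine lintegral_congr_ae (ha'.ae_eq_mk.mono fun x hx => ?_)
    refine lintegral_congr_ae (ha'.ae_eq_mk.mono fun y hy => ?_)
    simp only [← hx, ← hy]
  set a := a'
  rcases eq_or_ne (∫⁻ x, a x ^ r) 0 with h0 | h0
  · have hae : ∀ᵐ x, a x = 0 := by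
      have := (lintegral_eq_zero_iff (hm.pow_const r)).1 h0
      filter_upwards [this] with x hx
      simpa [hr0, hr0.not_gt] using hx
    have : ∫⁻ x, ∫⁻ y, a x * a y * ENNReal.ofReal ((1 + |x - y|) ^ (-μ)) = 0 := by
      rw [lintegral_eq_zero_of_ae_eq_zero]
      filter_upwards [hae] with x hx
      simp [hx]
    rw [this]; exact zero_le
  rcases eq_or_ne (∫⁻ x, a x ^ r) ∞ with ht | ht
  · rw [ht, ENNReal.top_rpow_of_pos (by positivity)]
    rw [show (∞ : ℝ≥0∞) ^ 2 = ∞ by simp, ENNReal.mul_top]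
    · exact le_top
    · simp [hc0]
  set A : ℝ := (∫⁻ x, a x ^ r).toReal with hAdef
  have hA : 0 < A := ENNReal.toReal_pos h0 ht
  have hint : ∫⁻ x, a x ^ r = ENNReal.ofReal A := (ENNReal.ofReal_toReal ht).symm
  have hfin : ∀ᵐ x, a x < ∞ := by
    filter_upwards [ae_lt_top (hm.pow_const r) ht] with x hx
    exact (ENNReal.rpow_lt_top_iff_of_pos hr0).1 hx
  set k : ℝ → ℝ → ℝ≥0∞ := fun x y => ENNReal.ofReal ((1 + |x - y|) ^ (-μ))
  have hk : Measurable (Function.uncurry k) := by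
    simp only [k, Function.uncurry_def]
    fun_prop
  -- The kernel is symmetric, so the double integral is at most twice its part over `a y ≤ a x`.
  -- There the preceding lemma applies with `h = a x` and gives the pointwise bound `a x * T x ≤ c
  -- A^{1-μ} (a x)^r`. Integrating yields `A^{2-μ} = A^{2/r}`.
  set T : ℝ → ℝ≥0∞ := fun x => ∫⁻ y, (if a y ≤ a x then a y else 0) * k x y with hT
  have hite : Measurable (fun z : ℝ × ℝ => if a z.2 ≤ a z.1 then a z.2 else 0) :=
    Measurable.ite (measurableSet_le (hm.comp measurable_snd) (hm.comp measurable_fst))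
      (hm.comp measurable_snd) measurable_const
  have hTx : ∀ᵐ x, a x * T x ≤ ENNReal.ofReal (c * A ^ (1 - μ)) * a x ^ r := by
    filter_upwards [hfin] with x hx
    rcases eq_or_ne (a x) 0 with hx0 | hx0
    · simp [hx0]
    set h : ℝ := (a x).toReal
    have hh : 0 < h := ENNReal.toReal_pos hx0 hx.ne
    have hax : a x = ENNReal.ofReal h := (ENNReal.ofReal_toReal hx.ne).symm
    have := lintegral_min_mul_rpow_neg_le hμ0 hμ1 hr hm hA hh hint x
    calc a x * T x ≤ ENNReal.ofReal h * ENNReal.ofReal (c * A ^ (1 - μ) * h ^ (r - 1)) := by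
          rw [hax]
          gcongr
          simp only [hT, hax]
          exact this
      _ = _ := by
          rw [hax, ENNReal.ofReal_rpow_of_pos hh, ← ENNReal.ofReal_mul hh.le,
            ← ENNReal.ofReal_mul (by positivity), Real.rpow_sub_one hh.ne']
          congr 1
          field_simp
  have hTint : ∫⁻ x, a x * T x ≤ ENNReal.ofReal (c * A ^ (1 - μ)) * ENNReal.ofReal A := by
    rw [← hint, ← lintegral_const_mul _ (hm.pow_const r)]
    exact lintegral_mono_ae hTx
  set S : ℝ → ℝ → ℝ≥0∞ := fun x y => a x * ((if a y ≤ a x then a y else 0) * k x y)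
  have hS : Measurable (Function.uncurry S) :=
    (hm.comp measurable_fst).mul (hite.mul hk)
  have hST : ∀ x, ∫⁻ y, S x y = a x * T x := fun x =>
    lintegral_const_mul _ ((hite.comp measurable_prodMk_left).mul (hk.comp measurable_prodMk_left))
  have hsym : ∀ x y, a x * a y * k x y ≤ S x y + S y x := by
    intro x y
    have hkk : k y x = k x y := by simp only [k, abs_sub_comm]
    rcases le_total (a y) (a x) with hxy | hxy
    · refine le_trans (le_of_eq ?_) le_self_add
      simp only [S, hxy, if_true, mul_assoc]
    · refine le_trans (le_of_eq ?_) le_add_self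
      simp only [S, hxy, if_true, hkk]
      ring
  have hswap : ∫⁻ x, ∫⁻ y, S y x = ∫⁻ x, ∫⁻ y, S x y :=
    (lintegral_lintegral_swap hS.aemeasurable).symm
  calc ∫⁻ x, ∫⁻ y, a x * a y * k x y ≤ ∫⁻ x, ∫⁻ y, (S x y + S y x) :=
        lintegral_mono fun x => lintegral_mono fun y => hsym x y
    _ = ∫⁻ x, ((∫⁻ y, S x y) + ∫⁻ y, S y x) :=
        lintegral_congr fun x => lintegral_add_left (hS.comp measurable_prodMk_left) _
    _ = (∫⁻ x, ∫⁻ y, S x y) + ∫⁻ x, ∫⁻ y, S y x := lintegral_add_left hS.lintegral_prod_right' _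
    _ = 2 * ∫⁻ x, a x * T x := by rw [hswap, ← two_mul]; simp only [hST]
    _ ≤ 2 * (ENNReal.ofReal (c * A ^ (1 - μ)) * ENNReal.ofReal A) := by gcongr
    _ = _ := by
        rw [hint, ENNReal.ofReal_rpow_of_pos hA, ← ENNReal.ofReal_pow (by positivity),
          show ((2 * c).toNNReal : ℝ≥0∞) = ENNReal.ofReal (2 * c) from rfl,
          ← ENNReal.ofReal_mul (by positivity), ← ENNReal.ofReal_mul (by positivity),
          show (2 : ℝ≥0∞) = ENNReal.ofReal 2 by simp, ← ENNReal.ofReal_mul (by norm_num)]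
        congr 1
        have : (A ^ (1 / r)) ^ 2 = A ^ (1 - μ) * A := by
          rw [← Real.rpow_natCast, ← Real.rpow_mul hA.le, ← Real.rpow_add_one hA.ne']
          congr 1
          field_simp
          push_cast
          linarith
        rw [this]; ring

end HardyLittlewoodSobolev

/-! ### Minkowski's integral inequality -/

section Minkowski

variable {α ι : Type*} [MeasurableSpace α] {ν : Measure α}

/-- Minkowski's integral inequality for finite sums. -/
theorem sum_lintegral_rpow_le_lintegral_sum_rpow (s : Finset ι) {g : ι → α → ℝ≥0∞}
    (hg : ∀ i, AEMeasurable (g i) ν) {m : ℝ} (hm : 1 ≤ m) :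
    (∑ i ∈ s, (∫⁻ t, g i t ∂ν) ^ m) ^ (1 / m) ≤ ∫⁻ t, (∑ i ∈ s, g i t ^ m) ^ (1 / m) ∂ν := by
  have hm0 : 0 < m := by linarith
  rcases hm.eq_or_lt with rfl | hm1
  · simp only [ENNReal.rpow_one, div_one]
    rw [lintegral_finsetSum' _ fun i _ => hg i]
  set B : ℝ≥0∞ := ∫⁻ t, (∑ i ∈ s, g i t ^ m) ^ (1 / m) ∂ν with hB
  have hgB : ∀ i ∈ s, ∫⁻ t, g i t ∂ν ≤ B := by
    intro i hi
    refine lintegral_mono fun t => ?_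
    calc g i t = (g i t ^ m) ^ (1 / m) := by
          rw [← ENNReal.rpow_mul, mul_one_div_cancel hm0.ne', ENNReal.rpow_one]
      _ ≤ _ := by
          gcongr
          exact Finset.single_le_sum (f := fun i => g i t ^ m) (fun _ _ => zero_le) hi
  rcases eq_or_ne B ∞ with hBt | hBt
  · rw [hBt]; exact le_top
  set b : ι → ℝ≥0∞ := fun i => ∫⁻ t, g i t ∂ν with hb
  have hbt : ∀ i ∈ s, b i ≠ ∞ := fun i hi => ne_top_of_le_ne_top hBt (hgB i hi)
  set Sb : ℝ≥0∞ := ∑ i ∈ s, b i ^ m with hSb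
  have hSbt : Sb ≠ ∞ := by
    rw [hSb, ENNReal.sum_ne_top]
    exact fun i hi => ENNReal.rpow_ne_top_of_nonneg hm0.le (hbt i hi)
  rcases eq_or_ne Sb 0 with hSb0 | hSb0
  · rw [hSb0, ENNReal.zero_rpow_of_pos (by positivity)]; exact zero_le
  have hconj : m.HolderConjugate (m / (m - 1)) := Real.HolderConjugate.conjExponent hm1
  have hm' : 0 < m - 1 := by linarith
  -- Duality: one factor `b i` is written as an integral, the sum against `b i ^ (m - 1)` is taken
  -- inside, and Hölder is applied to the sum. The common power of `Sb`, finite and nonzero, is then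
  -- cancelled.
  have key : Sb ≤ B * Sb ^ ((m - 1) / m) := by
    calc Sb = ∑ i ∈ s, ∫⁻ t, g i t * b i ^ (m - 1) ∂ν := by
          rw [hSb]
          refine Finset.sum_congr rfl fun i hi => ?_
          rw [lintegral_mul_const'' _ (hg i)]
          change _ = b i * _
          conv_lhs => rw [show m = 1 + (m - 1) by ring]
          rw [ENNReal.rpow_add_of_nonneg _ _ (by norm_num) hm'.le, ENNReal.rpow_one]
      _ = ∫⁻ t, ∑ i ∈ s, g i t * b i ^ (m - 1) ∂ν :=
          (lintegral_finsetSum' _ fun i _ => (hg i).mul_const _).symm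
      _ ≤ ∫⁻ t, (∑ i ∈ s, g i t ^ m) ^ (1 / m) * Sb ^ ((m - 1) / m) ∂ν := by
          refine lintegral_mono fun t => ?_
          refine (ENNReal.inner_le_Lp_mul_Lq s _ _ hconj).trans (le_of_eq ?_)
          congr 1
          rw [one_div_div, hSb]
          congr 1
          refine Finset.sum_congr rfl fun i hi => ?_
          rw [← ENNReal.rpow_mul, mul_div_cancel₀ _ hm'.ne']
      _ = B * Sb ^ ((m - 1) / m) := by
          rw [lintegral_mul_const'']
          exact (Finset.aemeasurable_fun_sum _ fun i _ => (hg i).pow_const m).pow_const _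
  have hsplit : Sb = Sb ^ (1 / m) * Sb ^ ((m - 1) / m) := by
    rw [← ENNReal.rpow_add _ _ hSb0 hSbt]
    have : 1 / m + (m - 1) / m = 1 := by field_simp; ring
    rw [this, ENNReal.rpow_one]
  have h0 : Sb ^ ((m - 1) / m) ≠ 0 := by
    simp [ENNReal.rpow_eq_zero_iff, hSb0, hSbt]
  have ht : Sb ^ ((m - 1) / m) ≠ ∞ := ENNReal.rpow_ne_top_of_nonneg (by positivity) hSbt
  have key' : Sb ^ (1 / m) * Sb ^ ((m - 1) / m) ≤ B * Sb ^ ((m - 1) / m) := hsplit ▸ key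
  exact (ENNReal.mul_le_mul_iff_left h0 ht).1 key'

/-- Minkowski's integral inequality for series. -/
theorem tsum_lintegral_rpow_le_lintegral_tsum_rpow {g : ι → α → ℝ≥0∞}
    (hg : ∀ i, AEMeasurable (g i) ν) {m : ℝ} (hm : 1 ≤ m) :
    (∑' i, (∫⁻ t, g i t ∂ν) ^ m) ^ (1 / m) ≤ ∫⁻ t, (∑' i, g i t ^ m) ^ (1 / m) ∂ν := by
  have hm0 : 0 < m := by linarith
  rw [one_div, ENNReal.rpow_inv_le_iff hm0, ENNReal.tsum_eq_iSup_sum]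
  refine iSup_le fun s => ?_
  rw [← ENNReal.rpow_inv_le_iff hm0, ← one_div]
  refine (sum_lintegral_rpow_le_lintegral_sum_rpow s hg hm).trans ?_
  refine lintegral_mono fun t => ?_
  gcongr
  exact ENNReal.sum_le_tsum s

end Minkowski

end ModulationSpace

end

noncomputable section

namespace ModulationSpace

variable {n : ℕ}

/-! ### Lattice points, weights and neighbourhoods in `ℤⁿ` -/

section Lattice

@[simp]
theorem latticePt_apply (k : Fin n → ℤ) (i : Fin n) : latticePt k i = k i := rfl

@[simp]
theorem latticePt_zero : latticePt (0 : Fin n → ℤ) = 0 := by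
  ext i; simp

theorem latticePt_add (k l : Fin n → ℤ) : latticePt (k + l) = latticePt k + latticePt l := by
  ext i; simp

theorem latticePt_sub (k l : Fin n → ℤ) : latticePt (k - l) = latticePt k - latticePt l := by
  ext i; simp

theorem finite_norm_sub_latticePt_le (x : Euc n) (R : ℝ) :
    {l : Fin n → ℤ | ‖x - latticePt l‖ ≤ R}.Finite := by
  refine (Set.Finite.pi' fun i => Set.finite_Icc ⌈x i - R⌉ ⌊x i + R⌋).subset fun l hl i => ?_
  have h : |x i - l i| ≤ R := by
    have := PiLp.norm_apply_le (x - latticePt l) i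
    simp only [PiLp.sub_apply, latticePt_apply, Real.norm_eq_abs] at this
    exact this.trans hl
  rw [abs_le] at h
  exact ⟨Int.ceil_le.2 (by linarith), Int.le_floor.2 (by linarith)⟩

theorem exists_norm_sub_latticePt_le (x : Euc n) :
    ∃ l : Fin n → ℤ, ‖x - latticePt l‖ ≤ √(n : ℝ) / 2 := by
  refine ⟨fun i => round (x i), ?_⟩
  rw [EuclideanSpace.norm_eq]
  calc √(∑ i, ‖(x - latticePt fun i => round (x i)) i‖ ^ 2) ≤ √(∑ _i : Fin n, (1 / 2 : ℝ) ^ 2) := by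
        gcongr with i
        simp only [PiLp.sub_apply, latticePt_apply, Real.norm_eq_abs]
        exact abs_sub_round (x i)
    _ = √(n : ℝ) / 2 := by
        rw [Finset.sum_const, Finset.card_univ, Fintype.card_fin, nsmul_eq_mul,
          Real.sqrt_mul (by positivity), Real.sqrt_sq (by norm_num)]
        ring

/-- A finite set of functions `ι → κ` lies in a product box, over which the sum factors. -/
theorem tsum_prod_le_pow {ι : Type*} [Fintype ι] {κ : Type*} (g : κ → ℝ≥0∞) :
    ∑' k : ι → κ, ∏ i, g (k i) ≤ (∑' m, g m) ^ Fintype.card ι := by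
  classical
  rw [ENNReal.tsum_eq_iSup_sum]
  refine iSup_le fun S => ?_
  set T : Finset κ := Finset.univ.biUnion fun i => S.image fun k => k i
  calc ∑ k ∈ S, ∏ i, g (k i) ≤ ∑ k ∈ Fintype.piFinset fun _ : ι => T, ∏ i, g (k i) := by
        refine Finset.sum_le_sum_of_subset fun k hk => ?_
        rw [Fintype.mem_piFinset]
        exact fun i => Finset.mem_biUnion.2 ⟨i, Finset.mem_univ _, Finset.mem_image_of_mem _ hk⟩
    _ = ∏ _i : ι, ∑ m ∈ T, g m := (Finset.prod_univ_sum _ _).symm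
    _ = (∑ m ∈ T, g m) ^ Fintype.card ι := by rw [Finset.prod_const, Finset.card_univ]
    _ ≤ _ := by gcongr; exact ENNReal.sum_le_tsum T

theorem summable_int_one_add_abs_rpow : Summable fun m : ℤ => (1 + |(m : ℝ)|) ^ (-2 : ℝ) := by
  have h : Summable fun m : ℕ => (1 + (m : ℝ)) ^ (-2 : ℝ) := by
    have := (summable_nat_add_iff 1).2 (Real.summable_nat_rpow (p := (-2 : ℝ)).2 (by norm_num))
    refine this.congr fun m => ?_
    push_cast
    rw [add_comm]
  exact Summable.of_nat_of_neg (by simpa using h) (by simpa using h)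

/-- Since `|k|` dominates each `|k_i|`, the weight is at most the product of the `(1 + |k_i|)^{-2}`,
which reduces the claim to a one-dimensional series. -/
theorem tsum_weight_lt_top : ∑' k : Fin n → ℤ, weight (-(2 * n)) k < ∞ := by
  set g : ℤ → ℝ≥0∞ := fun m => ENNReal.ofReal ((1 + |(m : ℝ)|) ^ (-2 : ℝ))
  have hg : ∑' m, g m < ∞ := by
    rw [← ENNReal.ofReal_tsum_of_nonneg (fun _ => by positivity) summable_int_one_add_abs_rpow]
    exact ENNReal.ofReal_lt_top
  have hle : ∀ k : Fin n → ℤ, weight (-(2 * n)) k ≤ ∏ i, g (k i) := by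
    intro k
    rw [weight, ← ENNReal.ofReal_prod_of_nonneg fun _ _ => by positivity]
    refine ENNReal.ofReal_le_ofReal ?_
    calc (1 + ‖latticePt k‖) ^ (-(2 * (n : ℝ)))
        = ∏ _i : Fin n, (1 + ‖latticePt k‖) ^ (-2 : ℝ) := by
          rw [Finset.prod_const, Finset.card_univ, Fintype.card_fin, ← Real.rpow_natCast,
            ← Real.rpow_mul (by positivity)]
          congr 1; ring
      _ ≤ ∏ i, (1 + |(k i : ℝ)|) ^ (-2 : ℝ) := by
          refine Finset.prod_le_prod (fun i _ => by positivity) fun i _ => ?_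
          refine Real.rpow_le_rpow_of_nonpos (by positivity) ?_ (by norm_num)
          gcongr
          simpa using PiLp.norm_apply_le (latticePt k) i
  calc _ ≤ ∑' k : Fin n → ℤ, ∏ i, g (k i) := ENNReal.tsum_le_tsum hle
    _ ≤ _ := tsum_prod_le_pow g
    _ < ∞ := ENNReal.pow_lt_top hg

theorem weight_ne_zero (s : ℝ) (k : Fin n → ℤ) : weight s k ≠ 0 := by
  simp only [weight, ne_eq, ENNReal.ofReal_eq_zero, not_le]
  positivity

theorem weight_ne_top (s : ℝ) (k : Fin n → ℤ) : weight s k ≠ ∞ := ENNReal.ofReal_ne_top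

theorem weight_add (s t : ℝ) (k : Fin n → ℤ) : weight (s + t) k = weight s k * weight t k := by
  rw [weight, weight, weight, ← ENNReal.ofReal_mul (by positivity), Real.rpow_add (by positivity)]

theorem weight_neg_mul_weight (s : ℝ) (k : Fin n → ℤ) : weight (-s) k * weight s k = 1 := by
  rw [← weight_add, neg_add_cancel, weight]; simp

/-- The finite set of lattice points `l` with `|l - k| ≤ 2 √n`. -/
def nbhd (k : Fin n → ℤ) : Finset (Fin n → ℤ) :=
  (finite_norm_sub_latticePt_le (0 : Euc n) (2 * √(n : ℝ))).toFinset.map (addLeftEmbedding k)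

theorem mem_nbhd {k l : Fin n → ℤ} : l ∈ nbhd k ↔ ‖latticePt l - latticePt k‖ ≤ 2 * √(n : ℝ) := by
  simp only [nbhd, Finset.mem_map, Set.Finite.mem_toFinset, Set.mem_ofPred_eq, zero_sub, norm_neg,
    addLeftEmbedding_apply]
  constructor
  · rintro ⟨m, hm, rfl⟩
    simpa [latticePt_add] using hm
  · intro h
    exact ⟨l - k, by rwa [latticePt_sub], by abel⟩

theorem card_nbhd (k : Fin n → ℤ) : (nbhd k).card = (nbhd (0 : Fin n → ℤ)).card := by
  simp [nbhd]

/-- Both signs of `s` come from `1 + ‖x‖ ≤ (1 + R) (1 + ‖y‖)`, with `x` and `y` exchanged when `s ≤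
0`. -/
theorem one_add_norm_rpow_le {E : Type*} [NormedAddCommGroup E] (s : ℝ) {R : ℝ} {x y : E}
    (hR : 0 ≤ R) (h : ‖x - y‖ ≤ R) : (1 + ‖x‖) ^ s ≤ (1 + R) ^ |s| * (1 + ‖y‖) ^ s := by
  have h1 : ‖x‖ ≤ ‖y‖ + R := by
    calc ‖x‖ = ‖y + (x - y)‖ := by abel_nf
      _ ≤ ‖y‖ + R := (norm_add_le _ _).trans (by gcongr)
  have h2 : ‖y‖ ≤ ‖x‖ + R := by
    calc ‖y‖ = ‖x - (x - y)‖ := by abel_nf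
      _ ≤ ‖x‖ + R := (norm_sub_le _ _).trans (by gcongr)
  have hx := norm_nonneg x
  have hy := norm_nonneg y
  rcases le_total 0 s with hs | hs
  · rw [abs_of_nonneg hs, ← Real.mul_rpow (by positivity) (by positivity)]
    exact Real.rpow_le_rpow (by positivity) (by nlinarith) hs
  · rw [abs_of_nonpos hs]
    obtain ⟨t, rfl⟩ : ∃ t, s = -t := ⟨-s, by ring⟩
    have ht : 0 ≤ t := by linarith
    rw [neg_neg, Real.rpow_neg (by positivity), Real.rpow_neg (by positivity), ← div_eq_mul_inv,
      inv_eq_one_div, div_le_div_iff₀ (by positivity) (by positivity), one_mul,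
      ← Real.mul_rpow (by positivity) (by positivity)]
    exact Real.rpow_le_rpow (by positivity) (by nlinarith) ht

/-- The weights at neighbouring lattice points are comparable. -/
theorem weight_le_of_mem_nbhd (s : ℝ) {k l : Fin n → ℤ} (h : l ∈ nbhd k) :
    weight s l ≤ ENNReal.ofReal ((1 + 2 * √(n : ℝ)) ^ |s|) * weight s k := by
  rw [weight, weight, ← ENNReal.ofReal_mul (by positivity)]
  exact ENNReal.ofReal_le_ofReal (one_add_norm_rpow_le s (by positivity) (mem_nbhd.1 h))

end Lattice

/-! ### The partition of unity `σ_k` -/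

section Sigma

variable {ρ : Euc n → ℝ}

theorem IsGenerator.finite_support (hρ : IsGenerator ρ) (ξ : Euc n) :
    (Function.support fun l : Fin n → ℤ => ρ (ξ - latticePt l)).Finite := by
  refine (finite_norm_sub_latticePt_le ξ (√(n : ℝ))).subset fun l hl => ?_
  by_contra hc
  exact hl (hρ.eq_zero _ (not_le.1 hc).le)

theorem IsGenerator.summable (hρ : IsGenerator ρ) (ξ : Euc n) :
    Summable fun l : Fin n → ℤ => ρ (ξ - latticePt l) :=
  summable_of_hasFiniteSupport (hρ.finite_support ξ)

theorem IsGenerator.tsum_pos (hρ : IsGenerator ρ) (ξ : Euc n) :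
    0 < ∑' l : Fin n → ℤ, ρ (ξ - latticePt l) := by
  obtain ⟨l, hl⟩ := exists_norm_sub_latticePt_le ξ
  exact (hρ.summable ξ).tsum_pos (fun l => hρ.nonneg _) l (by rw [hρ.eq_one _ hl]; norm_num)

theorem IsGenerator.contDiff_tsum (hρ : IsGenerator ρ) :
    ContDiff ℝ (⊤ : ℕ∞) fun ξ : Euc n => ∑' l : Fin n → ℤ, ρ (ξ - latticePt l) := by
  rw [contDiff_iff_contDiffAt]
  intro x
  -- On the unit ball about `x` only translates centred within `√n + 1` of `x` can be nonzero, so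
  -- the series is a fixed finite sum there.
  set S := (finite_norm_sub_latticePt_le x (√(n : ℝ) + 1)).toFinset
  have h : ContDiffAt ℝ (⊤ : ℕ∞) (fun ξ : Euc n => ∑ l ∈ S, ρ (ξ - latticePt l)) x :=
    ContDiffAt.sum fun l _ => (hρ.smooth.comp (contDiff_id.sub contDiff_const)).contDiffAt
  refine h.congr_of_eventuallyEq ?_
  filter_upwards [Metric.ball_mem_nhds x one_pos] with ξ hξ
  refine tsum_eq_sum fun l hl => hρ.eq_zero _ ?_
  simp only [S, Set.Finite.mem_toFinset, Set.mem_ofPred_eq, not_le] at hl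
  rw [Metric.mem_ball, dist_eq_norm] at hξ
  have : ‖x - latticePt l‖ ≤ ‖ξ - latticePt l‖ + ‖ξ - x‖ := by
    calc ‖x - latticePt l‖ = ‖(ξ - latticePt l) - (ξ - x)‖ := by abel_nf
      _ ≤ _ := norm_sub_le _ _
  linarith

theorem IsGenerator.contDiff_sigma (hρ : IsGenerator ρ) (k : Fin n → ℤ) :
    ContDiff ℝ (⊤ : ℕ∞) (sigma ρ k) :=
  (hρ.smooth.comp (contDiff_id.sub contDiff_const)).div hρ.contDiff_tsum
    fun ξ => (hρ.tsum_pos ξ).ne'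

theorem IsGenerator.sigma_eq_zero (hρ : IsGenerator ρ) {k : Fin n → ℤ} {ξ : Euc n}
    (h : √(n : ℝ) ≤ ‖ξ - latticePt k‖) : sigma ρ k ξ = 0 := by
  rw [sigma, hρ.eq_zero _ h, zero_div]

theorem IsGenerator.norm_sub_lt_of_sigma_ne_zero (hρ : IsGenerator ρ) {k : Fin n → ℤ} {ξ : Euc n}
    (h : sigma ρ k ξ ≠ 0) : ‖ξ - latticePt k‖ < √(n : ℝ) :=
  not_le.1 fun hc => h (hρ.sigma_eq_zero hc)

theorem IsGenerator.sigma_nonneg (hρ : IsGenerator ρ) (k : Fin n → ℤ) (ξ : Euc n) :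
    0 ≤ sigma ρ k ξ := div_nonneg (hρ.nonneg _) (hρ.tsum_pos ξ).le

theorem IsGenerator.sigma_le_one (hρ : IsGenerator ρ) (k : Fin n → ℤ) (ξ : Euc n) :
    sigma ρ k ξ ≤ 1 :=
  div_le_one_of_le₀ ((hρ.summable ξ).le_tsum k fun _ _ => hρ.nonneg _) (hρ.tsum_pos ξ).le

/-- The denominator is periodic under `ℤⁿ`. This is the source of all uniformity in `k` in the
kernel bounds. -/
theorem sigma_eq_sigma_zero (k : Fin n → ℤ) (ξ : Euc n) :
    sigma ρ k ξ = sigma ρ 0 (ξ - latticePt k) := by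
  simp only [sigma, latticePt_zero, sub_zero]
  congr 1
  rw [← (Equiv.addLeft k).tsum_eq]
  simp [latticePt_add, sub_sub]

theorem IsGenerator.sum_sigma_eq_one (hρ : IsGenerator ρ) {S : Finset (Fin n → ℤ)} {ξ : Euc n}
    (h : ∀ l ∉ S, sigma ρ l ξ = 0) : ∑ l ∈ S, sigma ρ l ξ = 1 := by
  have h0 : ∑' l : Fin n → ℤ, ρ (ξ - latticePt l) = ∑ l ∈ S, ρ (ξ - latticePt l) :=
    tsum_eq_sum fun l hl =>
      (div_eq_zero_iff.1 (h l hl)).resolve_right (hρ.tsum_pos ξ).ne'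
  simp only [sigma]
  rw [← Finset.sum_div, ← h0, div_self (hρ.tsum_pos ξ).ne']

/-- Each `σ_k` vanishes outside the ball of radius `√n` about `k`; this explains the radius `2 √n`
of `nbhd`. -/
theorem IsGenerator.mem_nbhd_of_sigma_ne_zero (hρ : IsGenerator ρ) {k l : Fin n → ℤ} {ξ : Euc n}
    (hk : sigma ρ k ξ ≠ 0) (hl : sigma ρ l ξ ≠ 0) : l ∈ nbhd k := by
  have h1 := hρ.norm_sub_lt_of_sigma_ne_zero hk
  have h2 := hρ.norm_sub_lt_of_sigma_ne_zero hl
  rw [mem_nbhd]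
  calc ‖latticePt l - latticePt k‖ = ‖(ξ - latticePt k) - (ξ - latticePt l)‖ := by abel_nf
    _ ≤ _ := norm_sub_le _ _
    _ ≤ _ := by linarith

theorem IsGenerator.sigma_mul_sigma_eq_zero (hρ : IsGenerator ρ) {k l : Fin n → ℤ}
    (h : l ∉ nbhd k) (ξ : Euc n) : sigma ρ l ξ * sigma ρ k ξ = 0 := by
  by_contra hc
  rw [mul_eq_zero, not_or] at hc
  exact h (hρ.mem_nbhd_of_sigma_ne_zero hc.2 hc.1)

/-- The partial sum over `nbhd k` equals `1` wherever `σ_k` is nonzero, so it reproduces anything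
localized by `σ_k`. -/
theorem IsGenerator.sum_sigma_mul_sigma (hρ : IsGenerator ρ) (k : Fin n → ℤ) (ξ : Euc n) :
    (∑ l ∈ nbhd k, sigma ρ l ξ) * sigma ρ k ξ = sigma ρ k ξ := by
  rcases eq_or_ne (sigma ρ k ξ) 0 with h | h
  · rw [h, mul_zero]
  · rw [hρ.sum_sigma_eq_one fun l hl => ?_, one_mul]
    by_contra hc
    exact hl (hρ.mem_nbhd_of_sigma_ne_zero h hc)

theorem IsGenerator.hasCompactSupport_sigma (hρ : IsGenerator ρ) (k : Fin n → ℤ) :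
    HasCompactSupport (sigma ρ k) :=
  HasCompactSupport.of_support_subset_isCompact (isCompact_closedBall (latticePt k) (√(n : ℝ)))
    fun ξ hξ => by
      rw [mem_closedBall_iff_norm]
      exact (hρ.norm_sub_lt_of_sigma_ne_zero hξ).le

/-- `σ_k` as a complex-valued function. -/
def sigmaC (ρ : Euc n → ℝ) (k : Fin n → ℤ) (ξ : Euc n) : ℂ := (sigma ρ k ξ : ℂ)

theorem IsGenerator.contDiff_sigmaC (hρ : IsGenerator ρ) (k : Fin n → ℤ) :
    ContDiff ℝ (⊤ : ℕ∞) (sigmaC ρ k) :=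
  Complex.ofRealCLM.contDiff.comp (hρ.contDiff_sigma k)

theorem IsGenerator.hasCompactSupport_sigmaC (hρ : IsGenerator ρ) (k : Fin n → ℤ) :
    HasCompactSupport (sigmaC ρ k) :=
  (hρ.hasCompactSupport_sigma k).comp_left (g := Complex.ofReal) Complex.ofReal_zero

theorem IsGenerator.hasTemperateGrowth_sigmaC (hρ : IsGenerator ρ) (k : Fin n → ℤ) :
    (sigmaC ρ k).HasTemperateGrowth :=
  (hρ.hasCompactSupport_sigmaC k).hasTemperateGrowth (hρ.contDiff_sigmaC k)

theorem IsGenerator.norm_sigmaC_le (hρ : IsGenerator ρ) (k : Fin n → ℤ) (ξ : Euc n) :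
    ‖sigmaC ρ k ξ‖ ≤ 1 := by
  rw [sigmaC, Complex.norm_real, Real.norm_eq_abs, abs_of_nonneg (hρ.sigma_nonneg k ξ)]
  exact hρ.sigma_le_one k ξ

/-- `σ_k` as a Schwartz function. -/
def sigmaS (hρ : IsGenerator ρ) (k : Fin n → ℤ) : 𝓢(Euc n, ℂ) :=
  (hρ.hasCompactSupport_sigmaC k).toSchwartzMap (hρ.contDiff_sigmaC k)

@[simp]
theorem sigmaS_apply (hρ : IsGenerator ρ) (k : Fin n → ℤ) (ξ : Euc n) :
    sigmaS hρ k ξ = sigmaC ρ k ξ := rfl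

theorem box_eq (k : Fin n → ℤ) (u : 𝓢'(Euc n, ℂ)) :
    box ρ k u = 𝓕⁻ (TemperedDistribution.smulLeftCLM ℂ (sigmaC ρ k) (𝓕 u)) := rfl

end Sigma

end ModulationSpace

end

noncomputable section

namespace ModulationSpace

variable {n : ℕ}

/-! ### Young's inequality, and its consequence `L^a → L²` -/

section Convolution

variable {G : Type*} [NormedAddCommGroup G] [MeasurableSpace G] [BorelSpace G]
  [SecondCountableTopology G] {ν : Measure G} [ν.IsAddLeftInvariant] [ν.IsNegInvariant]

theorem lintegral_convolution_le_of_holderConjugate {a b : ℝ} (hab : a.HolderConjugate b)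
    {K g : G → ℝ≥0∞} (hK : Measurable K) (hg : AEMeasurable g ν) (x : G) :
    ∫⁻ y, K (x - y) * g y ∂ν ≤ (∫⁻ y, K y ^ b ∂ν) ^ (1 / b) * (∫⁻ y, g y ^ a ∂ν) ^ (1 / a) := by
  refine (ENNReal.lintegral_mul_le_Lp_mul_Lq ν hab.symm
    (hK.comp (measurable_const.sub measurable_id)).aemeasurable hg).trans (le_of_eq ?_)
  congr 2
  exact lintegral_sub_left_eq_self (fun z => K z ^ b) x

/-- Young's inequality `‖K * g‖_a ≤ ‖K‖_1 ‖g‖_a` for nonnegative functions. -/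
theorem lintegral_convolution_rpow_le [SFinite ν] {a b : ℝ} (hab : a.HolderConjugate b)
    {K g : G → ℝ≥0∞} (hK : Measurable K) (hg : AEMeasurable g ν) :
    ∫⁻ x, (∫⁻ y, K (x - y) * g y ∂ν) ^ a ∂ν ≤ (∫⁻ y, K y ∂ν) ^ a * ∫⁻ y, g y ^ a ∂ν := by
  set κ := ∫⁻ y, K y ∂ν
  have ha := hab.pos
  have hb := hab.symm.pos
  have hKx : ∀ x, Measurable fun y => K (x - y) := fun x =>
    hK.comp (measurable_const.sub measurable_id)
  -- Hölder with respect to the measure `K(x - y) dy` of mass `κ`, by splitting `K = K^{1/b}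
  -- K^{1/a}`. Integrating in `x` then only needs Tonelli.
  have h1 : ∀ x, (∫⁻ y, K (x - y) * g y ∂ν) ^ a ≤
      κ ^ (a - 1) * ∫⁻ y, K (x - y) * g y ^ a ∂ν := by
    intro x
    have : ∫⁻ y, K (x - y) * g y ∂ν ≤
        κ ^ (1 / b) * (∫⁻ y, K (x - y) * g y ^ a ∂ν) ^ (1 / a) := by
      calc ∫⁻ y, K (x - y) * g y ∂ν
          = ∫⁻ y, K (x - y) ^ (1 / b) * (K (x - y) ^ (1 / a) * g y) ∂ν := by
            refine lintegral_congr fun y => ?_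
            rw [← mul_assoc, ← ENNReal.rpow_add_of_nonneg _ _ (by positivity) (by positivity),
              one_div, one_div, add_comm, hab.inv_add_inv_eq_one, ENNReal.rpow_one]
        _ ≤ (∫⁻ y, (K (x - y) ^ (1 / b)) ^ b ∂ν) ^ (1 / b) *
            (∫⁻ y, (K (x - y) ^ (1 / a) * g y) ^ a ∂ν) ^ (1 / a) :=
            ENNReal.lintegral_mul_le_Lp_mul_Lq ν hab.symm
              ((hKx x).pow_const _).aemeasurable (((hKx x).pow_const _).aemeasurable.mul hg)
        _ = _ := by
            congr 2
            · rw [show κ = ∫⁻ y, K (x - y) ∂ν from (lintegral_sub_left_eq_self K x).symm]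
              refine lintegral_congr fun y => ?_
              rw [← ENNReal.rpow_mul, one_div_mul_cancel hb.ne', ENNReal.rpow_one]
            · refine lintegral_congr fun y => ?_
              rw [ENNReal.mul_rpow_of_nonneg _ _ ha.le, ← ENNReal.rpow_mul,
                one_div_mul_cancel ha.ne', ENNReal.rpow_one]
    calc _ ≤ (κ ^ (1 / b) * (∫⁻ y, K (x - y) * g y ^ a ∂ν) ^ (1 / a)) ^ a := by gcongr
      _ = _ := by
        rw [ENNReal.mul_rpow_of_nonneg _ _ ha.le, ← ENNReal.rpow_mul, ← ENNReal.rpow_mul,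
          one_div_mul_cancel ha.ne', ENNReal.rpow_one]
        congr 2
        have := hab.sub_one_mul_conj
        field_simp
        linarith
  have hga : AEMeasurable (fun y => g y ^ a) ν := hg.pow_const a
  have hKg : AEMeasurable (fun z : G × G => K (z.1 - z.2) * g z.2 ^ a) (ν.prod ν) :=
    (hK.comp (measurable_fst.sub measurable_snd)).aemeasurable.mul
      (hga.comp_quasiMeasurePreserving Measure.quasiMeasurePreserving_snd)
  calc _ ≤ ∫⁻ x, κ ^ (a - 1) * ∫⁻ y, K (x - y) * g y ^ a ∂ν ∂ν := lintegral_mono h1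
    _ = κ ^ (a - 1) * ∫⁻ x, ∫⁻ y, K (x - y) * g y ^ a ∂ν ∂ν :=
      lintegral_const_mul'' _ hKg.lintegral_prod_right'
    _ = κ ^ (a - 1) * (κ * ∫⁻ y, g y ^ a ∂ν) := by
      congr 1
      rw [lintegral_lintegral_swap hKg, ← lintegral_const_mul'' _ hga]
      refine lintegral_congr fun y => ?_
      have hKy : Measurable fun x => K (x - y) := hK.comp (measurable_id.sub measurable_const)
      rw [lintegral_mul_const _ hKy]
      congr 1
      exact lintegral_sub_right_eq_self K y
    _ = _ := by
      rw [← mul_assoc]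
      congr 1
      conv_rhs => rw [show a = (a - 1) + 1 by ring]
      rw [ENNReal.rpow_add_of_nonneg _ _ hab.sub_one_pos.le (by norm_num), ENNReal.rpow_one]

/-- Interpolation by hand: of the two powers of the convolution, `2 - a` are bounded uniformly by
Hölder and the remaining `a` are integrated by Young's inequality. -/
theorem lintegral_convolution_sq_le [SFinite ν] {a b : ℝ} (hab : a.HolderConjugate b) (ha2 : a ≤ 2)
    {K g : G → ℝ≥0∞} (hK : Measurable K) (hg : AEMeasurable g ν) :
    ∫⁻ x, (∫⁻ y, K (x - y) * g y ∂ν) ^ (2 : ℝ) ∂ν ≤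
      (((∫⁻ y, K y ^ b ∂ν) ^ (1 / b)) ^ (2 - a) * (∫⁻ y, K y ∂ν) ^ a) *
        ((∫⁻ y, g y ^ a ∂ν) ^ (1 / a)) ^ (2 : ℝ) := by
  set N := (∫⁻ y, g y ^ a ∂ν) ^ (1 / a) with hN
  set Kb := (∫⁻ y, K y ^ b ∂ν) ^ (1 / b)
  have ha := hab.pos
  have hNa : ∫⁻ y, g y ^ a ∂ν = N ^ a := by
    rw [hN, ← ENNReal.rpow_mul, one_div_mul_cancel ha.ne', ENNReal.rpow_one]
  have h2a : 0 ≤ 2 - a := by linarith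
  calc _ ≤ ∫⁻ x, (Kb * N) ^ (2 - a) * (∫⁻ y, K (x - y) * g y ∂ν) ^ a ∂ν := by
        refine lintegral_mono fun x => ?_
        conv_lhs => rw [show (2 : ℝ) = (2 - a) + a by ring]
        rw [ENNReal.rpow_add_of_nonneg _ _ h2a ha.le]
        gcongr
        exact lintegral_convolution_le_of_holderConjugate hab hK hg x
    _ = (Kb * N) ^ (2 - a) * ∫⁻ x, (∫⁻ y, K (x - y) * g y ∂ν) ^ a ∂ν := by
        have hKg : AEMeasurable (fun z : G × G => K (z.1 - z.2) * g z.2) (ν.prod ν) :=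
          (hK.comp (measurable_fst.sub measurable_snd)).aemeasurable.mul
            (hg.comp_quasiMeasurePreserving Measure.quasiMeasurePreserving_snd)
        exact lintegral_const_mul'' _ (hKg.lintegral_prod_right'.pow_const a)
    _ ≤ (Kb * N) ^ (2 - a) * ((∫⁻ y, K y ∂ν) ^ a * N ^ a) := by
        rw [← hNa]
        gcongr
        exact lintegral_convolution_rpow_le hab hK hg
    _ = _ := by
        conv_rhs => rw [show (2 : ℝ) = (2 - a) + a by ring]
        rw [ENNReal.mul_rpow_of_nonneg _ _ h2a, ENNReal.rpow_add_of_nonneg _ _ h2a ha.le]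
        ring_nf

end Convolution

/-! ### The operators `□_k` as convolutions, bounded uniformly in `k` -/

section Box

variable {ρ : Euc n → ℝ}

/-- The convolution kernel of `□_k`. -/
def boxKernel (hρ : IsGenerator ρ) (k : Fin n → ℤ) : 𝓢(Euc n, ℂ) := 𝓕⁻ (sigmaS hρ k)

/-- Translating the symbol by `k` multiplies the kernel by a character, so its modulus does not
depend on `k`. -/
theorem norm_boxKernel (hρ : IsGenerator ρ) (k : Fin n → ℤ) (x : Euc n) :
    ‖boxKernel hρ k x‖ = ‖boxKernel hρ 0 x‖ := by
  have h : boxKernel hρ k x = Real.fourierChar (inner ℝ (latticePt k) x) • boxKernel hρ 0 x := by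
    simp only [boxKernel, SchwartzMap.fourierInv_coe, Real.fourierInv_eq]
    rw [← integral_add_right_eq_self _ (latticePt k), Circle.smul_def, ← integral_smul]
    refine integral_congr_ae (ae_of_all _ fun v => ?_)
    simp only [sigmaS_apply, sigmaC]
    rw [sigma_eq_sigma_zero, add_sub_cancel_right, inner_add_left, AddChar.map_add_eq_mul,
      ← Circle.smul_def, smul_smul, mul_comm]
  rw [h, Circle.norm_smul]

theorem fourierInv_fourierInv_apply (ψ : 𝓢(Euc n, ℂ)) (x : Euc n) :
    𝓕⁻ (𝓕⁻ ψ) x = ψ (-x) := by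
  rw [SchwartzMap.fourierInv_apply_eq, SchwartzMap.compCLMOfContinuousLinearEquiv_apply]
  simp

/-- The transpose of `□_k` on test functions. As `□_k` on distributions is defined by duality, this
formula is what identifies it with convolution by `boxKernel`. -/
theorem fourier_smulLeft_fourierInv_apply (hρ : IsGenerator ρ) (k : Fin n → ℤ) (ψ : 𝓢(Euc n, ℂ))
    (y : Euc n) :
    𝓕 (SchwartzMap.smulLeftCLM ℂ (sigmaC ρ k) (𝓕⁻ ψ)) y = ∫ x, ψ x * boxKernel hρ k (x - y) := by
  set B := ContinuousLinearMap.mul ℂ ℂ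
  have h1 : SchwartzMap.convolution B (boxKernel hρ k) (𝓕⁻ (𝓕⁻ ψ)) =
      𝓕⁻ (SchwartzMap.smulLeftCLM ℂ (sigmaC ρ k) (𝓕⁻ ψ)) := by
    refine (fourierInv_fourier_eq (F := 𝓢(Euc n, ℂ)) _).symm.trans ?_
    rw [SchwartzMap.fourier_convolution]
    congr 1
    ext ξ
    rw [SchwartzMap.smulLeftCLM_apply_apply (hρ.hasTemperateGrowth_sigmaC k)]
    simp [B, boxKernel]
  have h2 : 𝓕 (SchwartzMap.smulLeftCLM ℂ (sigmaC ρ k) (𝓕⁻ ψ)) y =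
      𝓕⁻ (SchwartzMap.smulLeftCLM ℂ (sigmaC ρ k) (𝓕⁻ ψ)) (-y) := by
    generalize SchwartzMap.smulLeftCLM ℂ (sigmaC ρ k) (𝓕⁻ ψ) = φ
    rw [SchwartzMap.fourierInv_apply_eq, SchwartzMap.compCLMOfContinuousLinearEquiv_apply]
    simp
  rw [h2, ← h1, SchwartzMap.convolution_apply]
  simp only [MeasureTheory.convolution, B, ContinuousLinearMap.mul_apply',
    fourierInv_fourierInv_apply]
  rw [← integral_sub_right_eq_self _ y]
  refine integral_congr_ae (ae_of_all _ fun x => ?_)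
  simp only [mul_comm (ψ x)]
  congr 2
  abel

/-- On `L^a`, `1 < a ≤ 2`, the operators `□_k` are bounded into `L^a` and into `L^2`, uniformly
in `k`. -/
theorem exists_box_bound (hρ : IsGenerator ρ) {a : ℝ≥0∞} [Fact (1 ≤ a)] (h1 : 1 < a) (h2 : a ≤ 2) :
    ∃ C : ℝ≥0, ∀ (k : Fin n → ℤ) (g : Lp ℂ a (volume : Measure (Euc n))),
      (∃ h : Lp ℂ a (volume : Measure (Euc n)),
        Lp.toTemperedDistribution h = box ρ k (Lp.toTemperedDistribution g) ∧ ‖h‖ₑ ≤ C * ‖g‖ₑ) ∧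
      (∃ h : Lp ℂ 2 (volume : Measure (Euc n)),
        Lp.toTemperedDistribution h = box ρ k (Lp.toTemperedDistribution g) ∧ ‖h‖ₑ ≤ C * ‖g‖ₑ) := by
  have hat : a ≠ ∞ := ne_top_of_le_ne_top (by simp) h2
  have ha0 : a ≠ 0 := by rintro rfl; simp at h1
  obtain ⟨α, rfl⟩ : ∃ α : ℝ≥0, a = α := ⟨a.toNNReal, (ENNReal.coe_toNNReal hat).symm⟩
  have hα1 : 1 < (α : ℝ) := by exact_mod_cast h1
  have hα2 : (α : ℝ) ≤ 2 := by exact_mod_cast h2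
  have hα0 : 0 < (α : ℝ) := by linarith
  set b : ℝ := Real.conjExponent α
  have hab : (α : ℝ).HolderConjugate b := Real.HolderConjugate.conjExponent hα1
  set K : Euc n → ℝ≥0∞ := fun x => ‖boxKernel hρ 0 x‖ₑ
  have hK : Measurable K := (boxKernel hρ 0).continuous.enorm.measurable
  set κ := ∫⁻ y, K y with hκ
  set Kb := (∫⁻ y, K y ^ b) ^ (1 / b)
  have hb0 := hab.symm.pos
  have hκt : κ ≠ ∞ := (boxKernel hρ 0).integrable.2.ne
  have hKbt : Kb ≠ ∞ := by
    have := (boxKernel hρ 0).eLpNorm_lt_top (ENNReal.ofReal b) volume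
    rw [eLpNorm_eq_lintegral_rpow_enorm_toReal (by simpa using hb0) (by simp),
      ENNReal.toReal_ofReal hb0.le] at this
    exact this.ne
  set C2 := (Kb ^ (2 - (α : ℝ)) * κ ^ (α : ℝ)) ^ (1 / 2 : ℝ)
  have hC2 : C2 ≠ ∞ := by
    refine ENNReal.rpow_ne_top_of_nonneg (by norm_num) (ENNReal.mul_ne_top ?_ ?_)
    · exact ENNReal.rpow_ne_top_of_nonneg (by linarith) hKbt
    · exact ENNReal.rpow_ne_top_of_nonneg hα0.le hκt
  refine ⟨(κ + C2).toNNReal, fun k g => ?_⟩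
  rw [ENNReal.coe_toNNReal (ENNReal.add_ne_top.2 ⟨hκt, hC2⟩)]
  have hg : AEMeasurable (fun y => ‖g y‖ₑ) := (Lp.aestronglyMeasurable g).enorm
  have hgN : ‖g‖ₑ = (∫⁻ y, ‖g y‖ₑ ^ (α : ℝ)) ^ (1 / (α : ℝ)) := by
    rw [Lp.enorm_def, eLpNorm_eq_lintegral_rpow_enorm_toReal ha0 hat]; rfl
  set h : Euc n → ℂ := fun x => ∫ y, boxKernel hρ k (x - y) * g y with hh
  set L : Euc n → ℝ≥0∞ := fun x => ∫⁻ y, K (x - y) * ‖g y‖ₑ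
  have henorm : ∀ x y, ‖boxKernel hρ k (x - y) * g y‖ₑ = K (x - y) * ‖g y‖ₑ := by
    intro x y
    rw [enorm_mul]
    congr 1
    rw [← ofReal_norm, norm_boxKernel, ofReal_norm]
  have hhL : ∀ x, ‖h x‖ₑ ≤ L x := fun x =>
    (enorm_integral_le_lintegral_enorm _).trans (lintegral_congr fun y => henorm x y).le
  have hmeas : AEStronglyMeasurable
      (fun z : Euc n × Euc n => boxKernel hρ k (z.1 - z.2) * g z.2) (volume.prod volume) :=
    ((boxKernel hρ k).continuous.comp (continuous_fst.sub continuous_snd)).aestronglyMeasurable.mul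
      (Lp.aestronglyMeasurable g).comp_snd
  have hhm : AEStronglyMeasurable h := hmeas.integral_prod_right'
  have hLa : eLpNorm h α volume ≤ κ * ‖g‖ₑ := by
    rw [eLpNorm_eq_lintegral_rpow_enorm_toReal ha0 hat, hgN, one_div,
      ENNReal.rpow_inv_le_iff (by simpa using hα0)]
    rw [ENNReal.mul_rpow_of_nonneg _ _ (by positivity), ← ENNReal.rpow_mul]
    simp only [ENNReal.coe_toReal]
    rw [one_div_mul_cancel hα0.ne', ENNReal.rpow_one]
    refine le_trans (lintegral_mono fun x => ?_) (lintegral_convolution_rpow_le hab hK hg)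
    gcongr
    exact hhL x
  have hL2 : eLpNorm h 2 volume ≤ C2 * ‖g‖ₑ := by
    rw [eLpNorm_eq_lintegral_rpow_enorm_toReal (by simp) (by simp), hgN, one_div,
      ENNReal.rpow_inv_le_iff (by simp)]
    rw [ENNReal.mul_rpow_of_nonneg _ _ (by positivity)]
    simp only [ENNReal.toReal_ofNat]
    refine le_trans (lintegral_mono fun x => ?_) ((lintegral_convolution_sq_le hab hα2 hK hg).trans
      (le_of_eq ?_))
    · gcongr
      exact hhL x
    · congr 1
      change Kb ^ (2 - (α : ℝ)) * κ ^ (α : ℝ) =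
        ((Kb ^ (2 - (α : ℝ)) * κ ^ (α : ℝ)) ^ (1 / 2 : ℝ)) ^ (2 : ℝ)
      generalize Kb ^ (2 - (α : ℝ)) * κ ^ (α : ℝ) = X
      rw [← ENNReal.rpow_mul]
      norm_num
  have hma : MemLp h α volume :=
    ⟨hhm, hLa.trans_lt (ENNReal.mul_lt_top hκt.lt_top enorm_lt_top)⟩
  have hm2 : MemLp h 2 volume :=
    ⟨hhm, hL2.trans_lt (ENNReal.mul_lt_top hC2.lt_top enorm_lt_top)⟩
  -- The convolution `h` represents `□_k g`, by Fubini. Absolute integrability holds because `K *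
  -- |g|` is bounded, by Hölder, and `ψ` is integrable.
  have hpair : ∀ ψ : 𝓢(Euc n, ℂ), ∫ x, ψ x • h x = box ρ k (Lp.toTemperedDistribution g) ψ := by
    intro ψ
    have e1 : box ρ k (Lp.toTemperedDistribution g) ψ =
        ∫ y, (∫ x, ψ x * boxKernel hρ k (x - y)) * g y := by
      change Lp.toTemperedDistribution g
        (𝓕 (SchwartzMap.smulLeftCLM ℂ (sigmaC ρ k) (𝓕⁻ ψ))) = _
      rw [Lp.toTemperedDistribution_apply]
      simp only [fourier_smulLeft_fourierInv_apply hρ, smul_eq_mul]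
    have hint : Integrable (fun z : Euc n × Euc n =>
        ψ z.1 * (boxKernel hρ k (z.1 - z.2) * g z.2)) (volume.prod volume) := by
      have hm' : AEStronglyMeasurable (fun z : Euc n × Euc n =>
          ψ z.1 * (boxKernel hρ k (z.1 - z.2) * g z.2)) (volume.prod volume) :=
        (ψ.continuous.comp continuous_fst).aestronglyMeasurable.mul hmeas
      refine ⟨hm', ?_⟩
      rw [HasFiniteIntegral, lintegral_prod _ hm'.enorm]
      calc _ = ∫⁻ x, ‖ψ x‖ₑ * L x := by
            refine lintegral_congr fun x => ?_
            simp only [enorm_mul]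
            rw [lintegral_const_mul' _ _ enorm_ne_top]
            simp only [← enorm_mul, henorm, L]
        _ ≤ ∫⁻ x, ‖ψ x‖ₑ * (Kb * ‖g‖ₑ) := by
            refine lintegral_mono fun x => ?_
            gcongr
            rw [hgN]
            exact lintegral_convolution_le_of_holderConjugate hab hK hg x
        _ = (∫⁻ x, ‖ψ x‖ₑ) * (Kb * ‖g‖ₑ) :=
            lintegral_mul_const _ ψ.continuous.enorm.measurable
        _ < ∞ := ENNReal.mul_lt_top ψ.integrable.2
            (ENNReal.mul_lt_top hKbt.lt_top enorm_lt_top)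
    calc ∫ x, ψ x • h x = ∫ x, ∫ y, ψ x * (boxKernel hρ k (x - y) * g y) := by
          simp only [hh, smul_eq_mul, integral_const_mul]
      _ = ∫ y, ∫ x, ψ x * (boxKernel hρ k (x - y) * g y) := integral_integral_swap hint
      _ = _ := by
          rw [e1]
          simp only [← mul_assoc, integral_mul_const]
  refine ⟨⟨hma.toLp h, ?_, ?_⟩, ⟨hm2.toLp h, ?_, ?_⟩⟩
  · ext ψ
    rw [Lp.toTemperedDistribution_apply, ← hpair ψ]
    exact integral_congr_ae (hma.coeFn_toLp.mono fun x hx => by simp only [hx])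
  · rw [Lp.enorm_toLp]
    exact hLa.trans (by gcongr; exact le_self_add)
  · ext ψ
    rw [Lp.toTemperedDistribution_apply, ← hpair ψ]
    exact integral_congr_ae (hm2.coeFn_toLp.mono fun x hx => by simp only [hx])
  · rw [Lp.enorm_toLp]
    exact hL2.trans (by gcongr; exact le_add_self)

end Box

end ModulationSpace

end

noncomputable section

namespace ModulationSpace

variable {n : ℕ}

/-! ### Density of compactly supported functions in the Schwartz space -/

section Density

variable {E : Type*} [NormedAddCommGroup E] [InnerProductSpace ℝ E] [FiniteDimensional ℝ E]

open Filter Topology in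
/-- Smooth cut-offs of a Schwartz function at scale `m` converge to it. -/
theorem exists_hasCompactSupport_tendsto (φ : 𝓢(E, ℂ)) :
    ∃ f : ℕ → 𝓢(E, ℂ), (∀ m, HasCompactSupport (f m)) ∧ Tendsto f atTop (𝓝 φ) := by
  let β : ContDiffBump (0 : E) := ⟨1, 2, one_pos, one_lt_two⟩
  have hβs : ContDiff ℝ (⊤ : ℕ∞) fun x => (β x : ℂ) := Complex.ofRealCLM.contDiff.comp β.contDiff
  have hβc : HasCompactSupport fun x => (β x : ℂ) :=
    β.hasCompactSupport.comp_left (g := Complex.ofReal) Complex.ofReal_zero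
  let χ : 𝓢(E, ℂ) := hβc.toSchwartzMap hβs
  have hχ1 : ∀ x : E, ‖x‖ ≤ 1 → χ x = 1 := by
    intro x hx
    have : β x = 1 := β.one_of_mem_closedBall (by simpa using hx)
    change ((β x : ℝ) : ℂ) = 1
    rw [this]; simp
  let c : ℕ → ℝ := fun m => ((m : ℝ) + 1)⁻¹
  have hc0 : ∀ m, 0 < c m := fun m => by positivity
  have hc1 : ∀ m, c m ≤ 1 := fun m => inv_le_one_of_one_le₀ (by linarith [m.cast_nonneg (α := ℝ)])
  let A : ∀ m : ℕ, E ≃L[ℝ] E := fun m =>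
    ContinuousLinearEquiv.smulLeft (Units.mk0 (c m) (hc0 m).ne')
  have hA : ∀ m x, A m x = c m • x := fun m x => rfl
  let χm : ℕ → 𝓢(E, ℂ) := fun m => SchwartzMap.compCLMOfContinuousLinearEquiv ℂ (A m) χ
  have hχm : ∀ m x, χm m x = χ (c m • x) := fun m x => rfl
  let f : ℕ → 𝓢(E, ℂ) := fun m => SchwartzMap.smulLeftCLM ℂ (χm m) φ
  have hf : ∀ m x, f m x = χm m x * φ x := fun m x => by
    simp [f, SchwartzMap.smulLeftCLM_apply_apply (χm m).hasTemperateGrowth]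
  refine ⟨f, fun m => ?_, ?_⟩
  · have h1 : HasCompactSupport (χm m) := by
      have : (χm m : E → ℂ) = (χ : E → ℂ) ∘ (A m).toHomeomorph := rfl
      rw [this]
      exact HasCompactSupport.comp_homeomorph hβc _
    have : (f m : E → ℂ) = fun x => χm m x * φ x := funext (hf m)
    rw [this]
    exact h1.mul_right
  have hD : ∀ (m i : ℕ) (x : E), ‖iteratedFDeriv ℝ i (χm m) x‖ ≤ SchwartzMap.seminorm ℝ 0 i χ := by
    intro m i x
    have e : (χm m : E → ℂ) = (χ : E → ℂ) ∘ ((A m : E →L[ℝ] E)) := rfl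
    rw [e, ContinuousLinearMap.iteratedFDeriv_comp_right _ (χ.smooth i) x le_rfl]
    refine (ContinuousMultilinearMap.norm_compContinuousLinearMap_le _ _).trans ?_
    have hAn : ‖(A m : E →L[ℝ] E)‖ ≤ 1 := by
      refine ContinuousLinearMap.opNorm_le_bound _ zero_le_one fun x => ?_
      change ‖c m • x‖ ≤ _
      rw [norm_smul, Real.norm_eq_abs, abs_of_pos (hc0 m)]
      exact mul_le_mul_of_nonneg_right (hc1 m) (norm_nonneg _)
    calc _ ≤ SchwartzMap.seminorm ℝ 0 i χ * ∏ _j : Fin i, (1 : ℝ) := by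
          gcongr
          exact χ.norm_iteratedFDeriv_le_seminorm ℝ i _
      _ = _ := by simp
  rw [(schwartz_withSeminorms ℝ E ℂ).tendsto_nhds]
  rintro ⟨k, j⟩ ε hε
  set D : ℝ := (∑ i ∈ Finset.range (j + 1), (j.choose i : ℝ) * SchwartzMap.seminorm ℝ 0 i χ *
    SchwartzMap.seminorm ℝ (k + 1) (j - i) φ) + SchwartzMap.seminorm ℝ (k + 1) j φ with hDdef
  have hbound : ∀ m, SchwartzMap.seminorm ℝ k j (f m - φ) ≤ c m * D := by
    intro m
    have hD0 : 0 ≤ D := by positivity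
    refine SchwartzMap.seminorm_le_bound ℝ k j _ (by have := hc0 m; positivity) fun x => ?_
    -- The error vanishes near points with `‖x‖ < (c m)⁻¹`. Elsewhere `1 ≤ c m * ‖x‖`, so raising
    -- the polynomial weight from `k` to `k + 1` gains the factor `c m`, which tends to `0`.
    rcases lt_or_ge ‖x‖ (c m)⁻¹ with hx | hx
    · have : (fun y => (f m - φ) y) =ᶠ[𝓝 x] fun _ => 0 := by
        have ho : IsOpen {y : E | ‖y‖ < (c m)⁻¹} := isOpen_lt continuous_norm continuous_const
        filter_upwards [ho.mem_nhds hx] with y hy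
        have hy' : ‖c m • y‖ ≤ 1 := by
          rw [norm_smul, Real.norm_eq_abs, abs_of_pos (hc0 m)]
          calc c m * ‖y‖ ≤ c m * (c m)⁻¹ := by
                have := hc0 m
                gcongr
            _ = 1 := mul_inv_cancel₀ (hc0 m).ne'
        simp [hf, hχm, hχ1 _ hy']
      have h0 := (this.iteratedFDeriv ℝ j).eq_of_nhds
      change ‖x‖ ^ k * ‖iteratedFDeriv ℝ j (fun y => (f m - φ) y) x‖ ≤ _
      rw [h0]
      have := hc0 m
      simp
      positivity
    · have hx1 : 1 ≤ c m * ‖x‖ := by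
        have := mul_le_mul_of_nonneg_left hx (hc0 m).le
        rwa [mul_inv_cancel₀ (hc0 m).ne'] at this
      have hxk : ‖x‖ ^ k ≤ c m * ‖x‖ ^ (k + 1) := by
        calc ‖x‖ ^ k = 1 * ‖x‖ ^ k := (one_mul _).symm
          _ ≤ (c m * ‖x‖) * ‖x‖ ^ k := by gcongr
          _ = _ := by ring
      have hsub : ‖iteratedFDeriv ℝ j (f m - φ) x‖ ≤
          ‖iteratedFDeriv ℝ j (f m) x‖ + ‖iteratedFDeriv ℝ j φ x‖ := by
        have : iteratedFDeriv ℝ j (f m - φ) x = iteratedFDeriv ℝ j (f m) x - iteratedFDeriv ℝ j φ x :=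
          iteratedFDeriv_sub_apply ((f m).smooth j).contDiffAt (φ.smooth j).contDiffAt
        rw [this]
        exact norm_sub_le _ _
      have hmul : ‖iteratedFDeriv ℝ j (f m) x‖ ≤ ∑ i ∈ Finset.range (j + 1),
          (j.choose i : ℝ) * ‖iteratedFDeriv ℝ i (χm m) x‖ * ‖iteratedFDeriv ℝ (j - i) φ x‖ := by
        have : (f m : E → ℂ) = fun x => χm m x * φ x := funext (hf m)
        rw [this]
        exact norm_iteratedFDeriv_mul_le ((χm m).smooth j) (φ.smooth j) x le_rfl
      calc ‖x‖ ^ k * ‖iteratedFDeriv ℝ j (f m - φ) x‖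
          ≤ (c m * ‖x‖ ^ (k + 1)) * ((∑ i ∈ Finset.range (j + 1),
            (j.choose i : ℝ) * SchwartzMap.seminorm ℝ 0 i χ * ‖iteratedFDeriv ℝ (j - i) φ x‖) +
              ‖iteratedFDeriv ℝ j φ x‖) := by
            have := hc0 m
            gcongr
            refine hsub.trans ?_
            gcongr
            refine hmul.trans ?_
            gcongr with i
            exact hD m i x
        _ = c m * ((∑ i ∈ Finset.range (j + 1), (j.choose i : ℝ) * SchwartzMap.seminorm ℝ 0 i χ *
            (‖x‖ ^ (k + 1) * ‖iteratedFDeriv ℝ (j - i) φ x‖)) +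
              ‖x‖ ^ (k + 1) * ‖iteratedFDeriv ℝ j φ x‖) := by
            rw [mul_assoc, mul_add, Finset.mul_sum]
            congr 2
            exact Finset.sum_congr rfl fun i _ => by ring
        _ ≤ c m * D := by
            have := hc0 m
            rw [hDdef]
            gcongr
            · exact SchwartzMap.le_seminorm ℝ _ _ φ x
            · exact SchwartzMap.le_seminorm ℝ _ _ φ x
  have hlim : Tendsto (fun m => c m * D) atTop (𝓝 0) := by
    have : Tendsto c atTop (𝓝 0) := by
      simpa [c, one_div] using tendsto_one_div_add_atTop_nhds_zero_nat (𝕜 := ℝ)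
    simpa using this.mul_const D
  filter_upwards [hlim.eventually (gt_mem_nhds hε)] with m hm
  exact (hbound m).trans_lt hm

/-- A tempered distribution is determined by its values on compactly supported functions. -/
theorem temperedDistribution_ext_of_hasCompactSupport {T S : 𝓢'(E, ℂ)}
    (h : ∀ φ : 𝓢(E, ℂ), HasCompactSupport φ → T φ = S φ) : T = S := by
  ext φ
  obtain ⟨f, hf, hlim⟩ := exists_hasCompactSupport_tendsto φ
  have h1 := (T.continuous.tendsto φ).comp hlim
  have h2 := (S.continuous.tendsto φ).comp hlim
  refine tendsto_nhds_unique h1 (h2.congr fun m => (h _ (hf m)).symm)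

end Density

/-! ### `L^p` functions as tempered distributions -/

section LebesgueNorm

variable {a b : ℝ≥0∞} [Fact (1 ≤ a)] [Fact (1 ≤ b)]

/-- Smooth compactly supported functions separate locally integrable ones. The exponents may differ,
so that the `L^{p'}`, `L^p` and `L²` representatives of one distribution can be interchanged. -/
theorem ae_eq_of_toTemperedDistribution_eq {g : Lp ℂ a (volume : Measure (Euc n))}
    {h : Lp ℂ b (volume : Measure (Euc n))}
    (hgh : Lp.toTemperedDistribution g = Lp.toTemperedDistribution h) : g =ᵐ[volume] h := by
  refine ae_eq_of_integral_contDiff_smul_eq ((Lp.memLp g).locallyIntegrable Fact.out)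
    ((Lp.memLp h).locallyIntegrable Fact.out) fun φ hφ hφc => ?_
  have hs : ContDiff ℝ (⊤ : ℕ∞) (Complex.ofRealCLM ∘ φ) := Complex.ofRealCLM.contDiff.comp hφ
  have hc : HasCompactSupport (Complex.ofRealCLM ∘ φ) := hφc.comp_left rfl
  have := congrArg (fun T : 𝓢'(Euc n, ℂ) => T (hc.toSchwartzMap hs)) hgh
  simpa using this

theorem toTemperedDistribution_injective :
    Function.Injective (Lp.toTemperedDistribution :
      Lp ℂ a (volume : Measure (Euc n)) → 𝓢'(Euc n, ℂ)) :=
  fun _ _ h => Lp.ext (ae_eq_of_toTemperedDistribution_eq h)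

theorem toTemperedDistribution_add (g h : Lp ℂ a (volume : Measure (Euc n))) :
    Lp.toTemperedDistribution (g + h) = Lp.toTemperedDistribution g + Lp.toTemperedDistribution h :=
  (Lp.toTemperedDistributionCLM ℂ volume a).map_add g h

theorem toTemperedDistribution_sum {ι : Type*} (S : Finset ι)
    (g : ι → Lp ℂ a (volume : Measure (Euc n))) :
    Lp.toTemperedDistribution (∑ i ∈ S, g i) = ∑ i ∈ S, Lp.toTemperedDistribution (g i) :=
  map_sum (Lp.toTemperedDistributionCLM ℂ volume a) g S

theorem lebNorm_toTemperedDistribution (g : Lp ℂ a (volume : Measure (Euc n))) :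
    lebNorm a (Lp.toTemperedDistribution g) = ‖g‖ₑ := by
  refine le_antisymm ?_ (le_iInf₂ fun h hh => ?_)
  · rw [lebNorm]
    exact iInf₂_le_of_le g rfl le_rfl
  rw [toTemperedDistribution_injective hh]

theorem exists_of_lebNorm_lt_top {u : 𝓢'(Euc n, ℂ)} (h : lebNorm a u < ∞) :
    ∃ g : Lp ℂ a (volume : Measure (Euc n)), Lp.toTemperedDistribution g = u := by
  by_contra! hc
  refine h.ne ?_
  simp only [lebNorm, iInf_eq_top]
  exact fun g hg => absurd hg (hc g)

theorem lebNorm_zero : lebNorm a (0 : 𝓢'(Euc n, ℂ)) = 0 := by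
  have : Lp.toTemperedDistribution (0 : Lp ℂ a (volume : Measure (Euc n))) = 0 :=
    (Lp.toTemperedDistributionCLM ℂ volume a).map_zero
  rw [← this, lebNorm_toTemperedDistribution, enorm_zero]

theorem lebNorm_add_le (u v : 𝓢'(Euc n, ℂ)) : lebNorm a (u + v) ≤ lebNorm a u + lebNorm a v := by
  rcases eq_or_ne (lebNorm a u) ∞ with hu | hu
  · simp [hu]
  rcases eq_or_ne (lebNorm a v) ∞ with hv | hv
  · simp [hv]
  obtain ⟨g, rfl⟩ := exists_of_lebNorm_lt_top hu.lt_top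
  obtain ⟨h, rfl⟩ := exists_of_lebNorm_lt_top hv.lt_top
  rw [← toTemperedDistribution_add]
  simp only [lebNorm_toTemperedDistribution]
  exact enorm_add_le g h

theorem lebNorm_sum_le {ι : Type*} (S : Finset ι) (u : ι → 𝓢'(Euc n, ℂ)) :
    lebNorm a (∑ i ∈ S, u i) ≤ ∑ i ∈ S, lebNorm a (u i) :=
  Finset.le_sum_of_subadditive _ lebNorm_zero.le lebNorm_add_le S u

end LebesgueNorm

/-- `L^2(ℝⁿ)`. -/
abbrev L2 (n : ℕ) : Type := Lp ℂ 2 (volume : Measure (Euc n))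

/-! ### Bounded multipliers on `L²` -/

section Multiplication

open Classical in
/-- Multiplication by an essentially bounded function on `L^2`. -/
def mulL2 (m : Euc n → ℂ) : L2 n →L[ℂ] L2 n :=
  if h : MemLp m ∞ (volume : Measure (Euc n)) then
    (ContinuousLinearMap.mul ℂ ℂ).holderL volume ∞ 2 2 (h.toLp m) else 0

theorem coeFn_mulL2 {m : Euc n → ℂ} (hm : MemLp m ∞ (volume : Measure (Euc n))) (f : L2 n) :
    mulL2 m f =ᵐ[volume] fun ξ => m ξ * f ξ := by
  rw [mulL2, dif_pos hm]
  filter_upwards [(ContinuousLinearMap.mul ℂ ℂ).coeFn_holder (r := 2) (hm.toLp m) f,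
    hm.coeFn_toLp] with ξ h1 h2
  simpa [h2] using h1

theorem norm_mulL2_le {m : Euc n → ℂ} (hm : MemLp m ∞ (volume : Measure (Euc n))) {C : ℝ}
    (hC : ∀ ξ, ‖m ξ‖ ≤ C) (f : L2 n) : ‖mulL2 m f‖ ≤ C * ‖f‖ := by
  refine Lp.norm_le_mul_norm_of_ae_le_mul ?_
  filter_upwards [coeFn_mulL2 hm f] with ξ h
  rw [h, norm_mul]
  gcongr
  exact hC ξ

theorem mulL2_mulL2 {m m' : Euc n → ℂ} (hm : MemLp m ∞ (volume : Measure (Euc n)))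
    (hm' : MemLp m' ∞ (volume : Measure (Euc n))) (f : L2 n) :
    mulL2 m (mulL2 m' f) = mulL2 (fun ξ => m ξ * m' ξ) f := by
  refine Lp.ext ?_
  have hmm : MemLp (fun ξ => m ξ * m' ξ) ∞ (volume : Measure (Euc n)) := hm'.mul hm
  filter_upwards [coeFn_mulL2 hm (mulL2 m' f), coeFn_mulL2 hm' f, coeFn_mulL2 hmm f]
    with ξ h1 h2 h3
  rw [h1, h2, h3, mul_assoc]

theorem mulL2_comm {m m' : Euc n → ℂ} (hm : MemLp m ∞ (volume : Measure (Euc n)))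
    (hm' : MemLp m' ∞ (volume : Measure (Euc n))) (f : L2 n) :
    mulL2 m (mulL2 m' f) = mulL2 m' (mulL2 m f) := by
  rw [mulL2_mulL2 hm hm', mulL2_mulL2 hm' hm]
  simp only [mul_comm]

theorem memLp_top_of_hasTemperateGrowth {m : Euc n → ℂ} (hm : m.HasTemperateGrowth) {C : ℝ}
    (hC : ∀ ξ, ‖m ξ‖ ≤ C) : MemLp m ∞ (volume : Measure (Euc n)) :=
  memLp_top_of_bound hm.1.continuous.aestronglyMeasurable C (ae_of_all _ hC)

theorem toTemperedDistribution_mulL2 {m : Euc n → ℂ} (hm : m.HasTemperateGrowth)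
    (hm' : MemLp m ∞ (volume : Measure (Euc n))) (f : L2 n) :
    Lp.toTemperedDistribution (mulL2 m f) =
      TemperedDistribution.smulLeftCLM ℂ m (Lp.toTemperedDistribution f) := by
  ext φ
  rw [Lp.toTemperedDistribution_apply, TemperedDistribution.smulLeftCLM_apply_apply,
    Lp.toTemperedDistribution_apply]
  refine integral_congr_ae ?_
  filter_upwards [coeFn_mulL2 hm' f] with ξ h
  rw [h, SchwartzMap.smulLeftCLM_apply_apply hm]
  simp only [smul_eq_mul]
  ring

end Multiplication

/-! ### The unitary group `e^{itP}` on the Fourier side -/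

section Propagator

variable {P : Euc n → ℝ}

/-- The symbol `e^{itP}`. -/
def propSymbol (P : Euc n → ℝ) (t : ℝ) (ξ : Euc n) : ℂ := Complex.exp (Complex.I * t * P ξ)

theorem norm_propSymbol (t : ℝ) (ξ : Euc n) : ‖propSymbol P t ξ‖ = 1 := by
  have : Complex.I * t * P ξ = ((t * P ξ : ℝ) : ℂ) * Complex.I := by push_cast; ring
  rw [propSymbol, this, Complex.norm_exp_ofReal_mul_I]

theorem memLp_propSymbol (hP : AEMeasurable P) (t : ℝ) :
    MemLp (propSymbol P t) ∞ (volume : Measure (Euc n)) := by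
  refine memLp_top_of_bound ?_ 1 (ae_of_all _ fun ξ => (norm_propSymbol t ξ).le)
  have : AEMeasurable (propSymbol P t) := by
    unfold propSymbol
    fun_prop
  exact this.aestronglyMeasurable

/-- The propagator `e^{itP}` on the Fourier side. -/
def prop (P : Euc n → ℝ) (t : ℝ) : L2 n →L[ℂ] L2 n := mulL2 (propSymbol P t)

theorem prop_prop (hP : AEMeasurable P) (s t : ℝ) (f : L2 n) :
    prop P s (prop P t f) = prop P (s + t) f := by
  rw [prop, prop, mulL2_mulL2 (memLp_propSymbol hP s) (memLp_propSymbol hP t), prop]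
  congr 2
  ext ξ
  rw [propSymbol, propSymbol, propSymbol, ← Complex.exp_add]
  congr 1
  push_cast
  ring

theorem prop_zero (hP : AEMeasurable P) (f : L2 n) : prop P 0 f = f := by
  refine Lp.ext ?_
  filter_upwards [coeFn_mulL2 (memLp_propSymbol hP 0) f] with ξ h
  rw [prop, h]
  simp [propSymbol]

theorem norm_prop (hP : AEMeasurable P) (t : ℝ) (f : L2 n) : ‖prop P t f‖ = ‖f‖ := by
  have h : ∀ s (g : L2 n), ‖prop P s g‖ ≤ ‖g‖ := fun s g => by
    simpa [prop] using norm_mulL2_le (memLp_propSymbol hP s) (fun ξ => (norm_propSymbol s ξ).le) g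
  refine le_antisymm (h t f) ?_
  have := h (-t) (prop P t f)
  rwa [prop_prop hP, neg_add_cancel, prop_zero hP] at this

theorem inner_prop_prop (hP : AEMeasurable P) (t : ℝ) (f g : L2 n) :
    inner ℂ (prop P t f) (prop P t g) = inner ℂ f g := by
  let A : L2 n →ₗᵢ[ℂ] L2 n := ⟨(prop P t).toLinearMap, norm_prop hP t⟩
  exact A.inner_map_map f g

open Filter Topology in
-- By unitarity `‖e^{itP} f - f‖² = 2 ‖f‖² - 2 Re ⟨e^{itP} f, f⟩`, and the inner product is
-- continuous in `t` by dominated convergence. The group law transfers continuity from `0` to every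
-- `t`.
theorem continuous_prop_apply (hP : AEMeasurable P) (f : L2 n) :
    Continuous fun t => prop P t f := by
  have hin : Continuous fun t => inner ℂ (prop P t f) f := by
    have e : ∀ t, inner ℂ (prop P t f) f = ∫ ξ, inner ℂ (propSymbol P t ξ * f ξ) (f ξ) := by
      intro t
      rw [L2.inner_def]
      refine integral_congr_ae ?_
      filter_upwards [coeFn_mulL2 (memLp_propSymbol hP t) f] with ξ h
      rw [prop, h]
    simp only [e]
    refine continuous_of_dominated (bound := fun ξ => ‖f ξ‖ ^ 2) (fun t => ?_) (fun t => ?_) ?_ ?_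
    · exact ((memLp_propSymbol hP t).1.mul (Lp.aestronglyMeasurable f)).inner
        (Lp.aestronglyMeasurable f)
    · refine ae_of_all _ fun ξ => (norm_inner_le_norm _ _).trans (le_of_eq ?_)
      rw [norm_mul, norm_propSymbol, one_mul, sq]
    · exact (Lp.memLp f).integrable_norm_pow two_ne_zero
    · refine ae_of_all _ fun ξ => ?_
      have : Continuous fun t : ℝ => propSymbol P t ξ := by
        unfold propSymbol
        fun_prop
      fun_prop
  have hn : ∀ t, ‖prop P t f - f‖ ^ 2 = 2 * ‖f‖ ^ 2 - 2 * (inner ℂ (prop P t f) f).re := by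
    intro t
    rw [@norm_sub_sq ℂ, norm_prop hP, RCLike.re_to_complex]
    ring
  have h0 : Tendsto (fun t => ‖prop P t f - f‖) (𝓝 0) (𝓝 0) := by
    have h2 : Tendsto (fun t => ‖prop P t f - f‖ ^ 2) (𝓝 0) (𝓝 0) := by
      simp only [hn]
      have hc : Continuous fun t => 2 * ‖f‖ ^ 2 - 2 * (inner ℂ (prop P t f) f).re := by fun_prop
      convert hc.tendsto 0 using 2
      rw [← hn 0, prop_zero hP]
      simp
    have := h2.sqrt
    simpa using this
  rw [continuous_iff_continuousAt]
  intro t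
  rw [ContinuousAt, tendsto_iff_norm_sub_tendsto_zero]
  have e : ∀ s, ‖prop P s f - prop P t f‖ = ‖prop P (s - t) f - f‖ := by
    intro s
    rw [← norm_prop hP t (prop P (s - t) f - f), map_sub, prop_prop hP,
      add_sub_cancel]
  simp only [e]
  have hs : Tendsto (fun s => s - t) (𝓝 t) (𝓝 0) := by
    simpa using (continuous_sub_right t).tendsto t
  exact h0.comp hs

/-- Joint continuity gives the strong measurability of `τ ↦ e^{-iτP} h(τ)` for measurable `h`. -/
theorem continuous_prop (hP : AEMeasurable P) :
    Continuous fun z : ℝ × L2 n => prop P z.1 z.2 := by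
  rw [continuous_iff_continuousAt]
  rintro ⟨t, f⟩
  rw [ContinuousAt, tendsto_iff_norm_sub_tendsto_zero]
  have hle : ∀ z : ℝ × L2 n, ‖prop P z.1 z.2 - prop P t f‖ ≤
      ‖z.2 - f‖ + ‖prop P z.1 f - prop P t f‖ := by
    intro z
    calc _ = ‖prop P z.1 (z.2 - f) + (prop P z.1 f - prop P t f)‖ := by
          rw [map_sub]; abel_nf
      _ ≤ _ := (norm_add_le _ _).trans (by rw [norm_prop hP])
  refine squeeze_zero (fun _ => norm_nonneg _) hle ?_
  have hc : Continuous fun z : ℝ × L2 n => ‖z.2 - f‖ + ‖prop P z.1 f - prop P t f‖ := by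
    have := (continuous_prop_apply hP f).comp (continuous_fst (X := ℝ) (Y := L2 n))
    simp only [Function.comp_def] at this
    fun_prop
  have := hc.tendsto (t, f)
  simpa using this

end Propagator

end ModulationSpace

end

noncomputable section

namespace ModulationSpace

variable {n : ℕ}

/-! ### Almost orthogonality of the `□_k` -/

section BoxAlgebra

variable {ρ : Euc n → ℝ}

theorem fourier_box (k : Fin n → ℤ) (u : 𝓢'(Euc n, ℂ)) :
    𝓕 (box ρ k u) = TemperedDistribution.smulLeftCLM ℂ (sigmaC ρ k) (𝓕 u) := by
  rw [box_eq, fourier_fourierInv_eq]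

theorem IsGenerator.box_box (hρ : IsGenerator ρ) (k l : Fin n → ℤ) (u : 𝓢'(Euc n, ℂ)) :
    box ρ l (box ρ k u) = 𝓕⁻ (TemperedDistribution.smulLeftCLM ℂ
      (fun ξ => sigmaC ρ l ξ * sigmaC ρ k ξ) (𝓕 u)) := by
  rw [box_eq, fourier_box, TemperedDistribution.smulLeftCLM_smulLeftCLM_apply
    (hρ.hasTemperateGrowth_sigmaC k) (hρ.hasTemperateGrowth_sigmaC l)]
  congr 2
  congr 1
  ext ξ
  exact mul_comm _ _

theorem IsGenerator.box_box_eq_zero (hρ : IsGenerator ρ) {k l : Fin n → ℤ} (h : l ∉ nbhd k)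
    (u : 𝓢'(Euc n, ℂ)) : box ρ l (box ρ k u) = 0 := by
  rw [hρ.box_box]
  have : (fun ξ => sigmaC ρ l ξ * sigmaC ρ k ξ) = fun _ => 0 := by
    ext ξ
    simp only [sigmaC, ← Complex.ofReal_mul, hρ.sigma_mul_sigma_eq_zero h, Complex.ofReal_zero]
  have h0 : TemperedDistribution.smulLeftCLM ℂ (fun _ : Euc n => (0 : ℂ)) (𝓕 u) = 0 := by
    ext φ
    simp
  rw [this, h0]
  exact (fourierInvCLM ℂ 𝓢'(Euc n, ℂ)).map_zero

theorem IsGenerator.sum_sigmaC_mul_sigmaC (hρ : IsGenerator ρ) (k : Fin n → ℤ) (ξ : Euc n) :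
    ∑ l ∈ nbhd k, sigmaC ρ l ξ * sigmaC ρ k ξ = sigmaC ρ k ξ := by
  rw [← Finset.sum_mul]
  simp only [sigmaC, ← Complex.ofReal_sum, ← Complex.ofReal_mul, hρ.sum_sigma_mul_sigma]

theorem IsGenerator.sum_smulLeft_sigmaC (hρ : IsGenerator ρ) (k : Fin n → ℤ)
    (T : 𝓢'(Euc n, ℂ)) :
    ∑ l ∈ nbhd k, TemperedDistribution.smulLeftCLM ℂ (sigmaC ρ l)
      (TemperedDistribution.smulLeftCLM ℂ (sigmaC ρ k) T) =
        TemperedDistribution.smulLeftCLM ℂ (sigmaC ρ k) T := by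
  have h1 : ∀ l ∈ nbhd k, (fun ξ => sigmaC ρ l ξ * sigmaC ρ k ξ).HasTemperateGrowth := fun l _ =>
    (hρ.hasTemperateGrowth_sigmaC l).mul (hρ.hasTemperateGrowth_sigmaC k)
  have h2 := TemperedDistribution.smulLeftCLM_sum (F := ℂ) h1
  simp only [hρ.sum_sigmaC_mul_sigmaC] at h2
  have h3 := congrArg (fun A => A T) h2
  simp only [_root_.sum_apply] at h3
  refine Eq.trans ?_ h3.symm
  refine Finset.sum_congr rfl fun l _ => ?_
  rw [TemperedDistribution.smulLeftCLM_smulLeftCLM_apply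
    (hρ.hasTemperateGrowth_sigmaC k) (hρ.hasTemperateGrowth_sigmaC l)]
  congr 1
  congr 1
  ext ξ
  exact mul_comm _ _

theorem IsGenerator.sum_box_box (hρ : IsGenerator ρ) (k : Fin n → ℤ) (u : 𝓢'(Euc n, ℂ)) :
    ∑ l ∈ nbhd k, box ρ l (box ρ k u) = box ρ k u := by
  simp only [box_eq, fourier_fourierInv_eq]
  conv_rhs => rw [← hρ.sum_smulLeft_sigmaC k (𝓕 u)]
  exact (map_sum (fourierInvCLM ℂ 𝓢'(Euc n, ℂ)) _ _).symm

theorem IsGenerator.memLp_sigmaC (hρ : IsGenerator ρ) (k : Fin n → ℤ) :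
    MemLp (sigmaC ρ k) ∞ (volume : Measure (Euc n)) :=
  memLp_top_of_hasTemperateGrowth (hρ.hasTemperateGrowth_sigmaC k) (hρ.norm_sigmaC_le k)

theorem IsGenerator.box_toTemperedDistribution (hρ : IsGenerator ρ) (k : Fin n → ℤ) (h : L2 n) :
    box ρ k (Lp.toTemperedDistribution h) =
      Lp.toTemperedDistribution (𝓕⁻ (mulL2 (sigmaC ρ k) (𝓕 h))) := by
  rw [box_eq, Lp.fourier_toTemperedDistribution_eq, ← toTemperedDistribution_mulL2
    (hρ.hasTemperateGrowth_sigmaC k) (hρ.memLp_sigmaC k), Lp.fourierInv_toTemperedDistribution_eq]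

/-- The form in which frequency localization near `k` is used in `L²`: the finitely many `σ_l`
around `k` reproduce the Fourier transform. -/
theorem IsGenerator.sum_mulL2_sigmaC (hρ : IsGenerator ρ) {k : Fin n → ℤ} {v : L2 n}
    {u : 𝓢'(Euc n, ℂ)} (h : Lp.toTemperedDistribution v = box ρ k u) :
    ∑ l ∈ nbhd k, mulL2 (sigmaC ρ l) (𝓕 v) = 𝓕 v := by
  apply toTemperedDistribution_injective
  rw [toTemperedDistribution_sum]
  simp only [toTemperedDistribution_mulL2 (hρ.hasTemperateGrowth_sigmaC _) (hρ.memLp_sigmaC _),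
    ← Lp.fourier_toTemperedDistribution_eq, h, fourier_box]
  exact hρ.sum_smulLeft_sigmaC k (𝓕 u)

end BoxAlgebra

/-! ### Distributions whose Fourier transform is a function -/

section Represented

theorem IsRepresentedBy.congr_ae {u : 𝓢'(Euc n, ℂ)} {g h : Euc n → ℂ} (hu : IsRepresentedBy u g)
    (hgh : g =ᵐ[volume] h) : IsRepresentedBy u h := by
  intro φ
  have e : (fun ξ => φ ξ * g ξ) =ᵐ[volume] fun ξ => φ ξ * h ξ :=
    hgh.mono fun ξ hξ => by simp only [hξ]
  exact ⟨(hu φ).1.congr e, (hu φ).2.trans (integral_congr_ae e)⟩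

theorem isRepresentedBy_toTemperedDistribution (h : L2 n) :
    IsRepresentedBy (Lp.toTemperedDistribution h) h := fun φ =>
  ⟨(φ.memLp 2 volume).integrable_mul (Lp.memLp h), by simp [Lp.toTemperedDistribution_apply]⟩

theorem isRepresentedBy_smulLeft {J : Euc n → ℂ} (hJ : J.HasTemperateGrowth) (h : L2 n) :
    IsRepresentedBy (TemperedDistribution.smulLeftCLM ℂ J (Lp.toTemperedDistribution h))
      (fun ξ => J ξ * h ξ) := by
  intro φ
  have := isRepresentedBy_toTemperedDistribution h (SchwartzMap.smulLeftCLM ℂ J φ)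
  simp only [SchwartzMap.smulLeftCLM_apply_apply hJ, smul_eq_mul] at this
  rw [TemperedDistribution.smulLeftCLM_apply_apply]
  have e : ∀ ξ, J ξ * φ ξ * h ξ = φ ξ * (J ξ * h ξ) := fun ξ => by ring
  simpa only [e] using this

/-- The propagator acts as expected on `𝓕⁻ (J h)`, where `h` is in `L^2`. -/
theorem isPropagated_fourierInv_smulLeft {P : Euc n → ℝ} (hP : AEMeasurable P) {J : Euc n → ℂ}
    (hJ : J.HasTemperateGrowth) (t : ℝ) (h : L2 n) {u v : 𝓢'(Euc n, ℂ)}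
    (hu : 𝓕 u = TemperedDistribution.smulLeftCLM ℂ J (Lp.toTemperedDistribution h))
    (hv : 𝓕 v = TemperedDistribution.smulLeftCLM ℂ J (Lp.toTemperedDistribution (prop P t h))) :
    IsPropagated P t u v := by
  refine ⟨fun ξ => J ξ * h ξ, hu ▸ isRepresentedBy_smulLeft hJ h, ?_⟩
  rw [hv]
  refine (isRepresentedBy_smulLeft hJ (prop P t h)).congr_ae ?_
  filter_upwards [coeFn_mulL2 (memLp_propSymbol hP t) h] with ξ hξ
  rw [prop, hξ, propSymbol]
  ring

end Represented

/-! ### The dispersive estimate on a single frequency piece -/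

section Dispersive

variable {ρ : Euc n → ℝ}

theorem weight_mul_lebNorm_box_le_modNorm {a : ℝ≥0∞} [Fact (1 ≤ a)] {q : ℝ} (hq : 0 < q) (s : ℝ)
    (l : Fin n → ℤ) (u : 𝓢'(Euc n, ℂ)) :
    weight s l * lebNorm a (box ρ l u) ≤ modNorm ρ s a q u := by
  rw [modNorm, one_div, ENNReal.le_rpow_inv_iff hq]
  exact ENNReal.le_tsum (f := fun k => (weight s k * lebNorm a (box ρ k u)) ^ q) l

/-- The modulation norm of a function localized in frequency near `k`. -/
theorem IsGenerator.exists_modNorm_le (hρ : IsGenerator ρ) {a : ℝ≥0∞} [Fact (1 ≤ a)] (h1 : 1 < a)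
    (h2 : a ≤ 2) {q : ℝ} (hq : 0 < q) (s : ℝ) :
    ∃ C : ℝ≥0, ∀ (k : Fin n → ℤ) (g : Lp ℂ a (volume : Measure (Euc n))) (u : 𝓢'(Euc n, ℂ)),
      Lp.toTemperedDistribution g = box ρ k u →
        modNorm ρ s a q (Lp.toTemperedDistribution g) ≤ C * (weight s k * ‖g‖ₑ) := by
  obtain ⟨C, hC⟩ := exists_box_bound hρ h1 h2
  set W : ℝ≥0∞ := ENNReal.ofReal ((1 + 2 * √(n : ℝ)) ^ |s|)
  set N : ℝ≥0∞ := ((nbhd (0 : Fin n → ℤ)).card : ℝ≥0∞) ^ (1 / q)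
  have hN : N ≠ ∞ := ENNReal.rpow_ne_top_of_nonneg (by positivity) (ENNReal.natCast_ne_top _)
  refine ⟨(N * (W * C)).toNNReal, fun k g u hu => ?_⟩
  rw [ENNReal.coe_toNNReal (ENNReal.mul_ne_top hN
    (ENNReal.mul_ne_top ENNReal.ofReal_ne_top ENNReal.coe_ne_top))]
  set X : ℝ≥0∞ := W * weight s k * (C * ‖g‖ₑ)
  have hterm : ∀ l ∈ nbhd k, (weight s l * lebNorm a (box ρ l (Lp.toTemperedDistribution g))) ^ q ≤
      X ^ q := by
    intro l hl
    obtain ⟨h, hh, hle⟩ := (hC l g).1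
    rw [← hh, lebNorm_toTemperedDistribution]
    gcongr
    exact mul_le_mul' (weight_le_of_mem_nbhd s hl) hle
  have hzero : ∀ l ∉ nbhd k,
      (weight s l * lebNorm a (box ρ l (Lp.toTemperedDistribution g))) ^ q = 0 := by
    intro l hl
    rw [hu, hρ.box_box_eq_zero hl, lebNorm_zero, mul_zero, ENNReal.zero_rpow_of_pos hq]
  calc modNorm ρ s a q (Lp.toTemperedDistribution g)
      = (∑ l ∈ nbhd k, (weight s l * lebNorm a (box ρ l (Lp.toTemperedDistribution g))) ^ q) ^
          (1 / q) := by
        rw [modNorm, tsum_eq_sum hzero]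
    _ ≤ ((nbhd k).card • X ^ q) ^ (1 / q) := by
        gcongr
        exact Finset.sum_le_card_nsmul _ _ _ hterm
    _ = N * X := by
        rw [card_nbhd, nsmul_eq_mul, ENNReal.mul_rpow_of_nonneg _ _ (by positivity),
          ← ENNReal.rpow_mul, mul_one_div_cancel hq.ne', ENNReal.rpow_one]
    _ = _ := by simp only [X]; ring

/-- Hölder's inequality, once the `L^a` and `L^b` functions are identified almost everywhere with
the `L²` ones. -/
theorem enorm_inner_le {a b : ℝ≥0∞} [Fact (1 ≤ a)] [Fact (1 ≤ b)] (hab : a.HolderConjugate b)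
    {v w : L2 n} {g : Lp ℂ a (volume : Measure (Euc n))} {h : Lp ℂ b (volume : Measure (Euc n))}
    (hg : Lp.toTemperedDistribution g = Lp.toTemperedDistribution v)
    (hh : Lp.toTemperedDistribution h = Lp.toTemperedDistribution w) :
    ‖(inner ℂ w v : ℂ)‖ₑ ≤ ‖g‖ₑ * ‖h‖ₑ := by
  rw [L2.inner_def]
  refine (enorm_integral_le_lintegral_enorm _).trans ?_
  have e : ∀ᵐ ξ, ‖(inner ℂ (w ξ) (v ξ) : ℂ)‖ₑ = ‖((g : Euc n → ℂ) • (h : Euc n → ℂ)) ξ‖ₑ := by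
    filter_upwards [ae_eq_of_toTemperedDistribution_eq hg,
      ae_eq_of_toTemperedDistribution_eq hh] with ξ h1 h2
    rw [Pi.smul_apply', h1, h2, smul_eq_mul, ← ofReal_norm, ← ofReal_norm, RCLike.inner_apply,
      norm_mul, norm_mul, RCLike.norm_conj]
  rw [lintegral_congr_ae e, ← eLpNorm_one_eq_lintegral_enorm, Lp.enorm_def, Lp.enorm_def]
  exact eLpNorm_smul_le_mul_eLpNorm (Lp.aestronglyMeasurable h) (Lp.aestronglyMeasurable g)

/-- The dispersive estimate, for frequencies near `k` and in the form of a bound for the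
sesquilinear form of the propagator. -/
theorem IsGenerator.exists_enorm_inner_prop_le (hρ : IsGenerator ρ) {P : Euc n → ℝ}
    (hP : AEMeasurable P) {p p' : ℝ≥0∞} [Fact (1 ≤ p)] [Fact (1 ≤ p')]
    (hpp' : p.HolderConjugate p') (h1 : 1 < p') (h2 : p' ≤ 2) {q : ℝ} (hq : 0 < q) {α δ μ : ℝ}
    (hU : DispersiveEstimate ρ P p p' q α δ μ) :
    ∃ C : ℝ≥0, ∀ (k : Fin n → ℤ) (t : ℝ) (v w : L2 n)
      (g h : Lp ℂ p' (volume : Measure (Euc n))) (u : 𝓢'(Euc n, ℂ)),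
      Lp.toTemperedDistribution v = box ρ k u →
      Lp.toTemperedDistribution g = Lp.toTemperedDistribution v →
      Lp.toTemperedDistribution h = Lp.toTemperedDistribution w →
        ‖(inner ℂ (𝓕 w) (prop P t (𝓕 v)) : ℂ)‖ₑ ≤
          C * weight δ k * ENNReal.ofReal ((1 + |t|) ^ (-μ)) * (‖g‖ₑ * ‖h‖ₑ) := by
  obtain ⟨A, hA⟩ := hU
  obtain ⟨C, hC⟩ := hρ.exists_modNorm_le h1 h2 hq (α + δ)
  set W : ℝ≥0 := Real.toNNReal ((1 + 2 * √(n : ℝ)) ^ |-α|)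
  set N : ℝ≥0 := ((nbhd (0 : Fin n → ℤ)).card : ℝ≥0)
  refine ⟨N * (W * (A * C)), fun k t v w g h u hv hg hh => ?_⟩
  set vt : L2 n := 𝓕⁻ (prop P t (𝓕 v))
  have hvt : 𝓕 vt = prop P t (𝓕 v) := fourier_fourierInv_eq _
  set D : ℝ≥0∞ := ENNReal.ofReal ((1 + |t|) ^ (-μ))
  have hX : modNorm ρ (α + δ) p' q (Lp.toTemperedDistribution v) ≤
      C * (weight (α + δ) k * ‖g‖ₑ) := by
    rw [← hg]
    exact hC k g u (hg.trans hv)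
  have hXt : modNorm ρ (α + δ) p' q (Lp.toTemperedDistribution v) < ∞ :=
    hX.trans_lt (ENNReal.mul_lt_top ENNReal.coe_lt_top
      (ENNReal.mul_lt_top (weight_ne_top _ _).lt_top enorm_lt_top))
  have hprop : IsPropagated P t (Lp.toTemperedDistribution v) (Lp.toTemperedDistribution vt) := by
    have hone : (fun _ : Euc n => (1 : ℂ)).HasTemperateGrowth :=
      Function.HasTemperateGrowth.const 1
    refine isPropagated_fourierInv_smulLeft hP hone t (𝓕 v) ?_ ?_ <;>
      rw [Lp.fourier_toTemperedDistribution_eq, TemperedDistribution.smulLeftCLM_const, one_smul]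
    rw [hvt]
  have hmod := hA t _ _ hXt hprop
  -- The propagator commutes with the `□_l`, so `U(t) v` stays localized near `k` and its `L^p` norm
  -- is controlled by boundedly many terms of its modulation norm.
  have hsum : ∑ l ∈ nbhd k, box ρ l (Lp.toTemperedDistribution vt) =
      Lp.toTemperedDistribution vt := by
    simp only [hρ.box_toTemperedDistribution, hvt]
    rw [← toTemperedDistribution_sum]
    congr 1
    have e : ∀ l ∈ nbhd k, 𝓕⁻ (mulL2 (sigmaC ρ l) (prop P t (𝓕 v))) =
        (fourierInvCLM ℂ (L2 n)) (prop P t (mulL2 (sigmaC ρ l) (𝓕 v))) := fun l _ => by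
      rw [prop, mulL2_comm (hρ.memLp_sigmaC l) (memLp_propSymbol hP t)]; rfl
    rw [Finset.sum_congr rfl e, ← map_sum, ← map_sum, hρ.sum_mulL2_sigmaC hv]
    rfl
  have hbox : ∀ l ∈ nbhd k, lebNorm p (box ρ l (Lp.toTemperedDistribution vt)) ≤
      W * weight (-α) k * (A * D * (C * (weight (α + δ) k * ‖g‖ₑ))) := by
    intro l hl
    calc lebNorm p (box ρ l (Lp.toTemperedDistribution vt))
        = weight (-α) l * (weight α l * lebNorm p (box ρ l (Lp.toTemperedDistribution vt))) := by
          rw [← mul_assoc, weight_neg_mul_weight, one_mul]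
      _ ≤ W * weight (-α) k * (A * D * (C * (weight (α + δ) k * ‖g‖ₑ))) := by
          refine mul_le_mul' (weight_le_of_mem_nbhd _ hl) ?_
          refine (weight_mul_lebNorm_box_le_modNorm hq α l _).trans (hmod.trans ?_)
          gcongr
  have hleb : lebNorm p (Lp.toTemperedDistribution vt) ≤
      N * (W * weight (-α) k * (A * D * (C * (weight (α + δ) k * ‖g‖ₑ)))) := by
    conv_lhs => rw [← hsum]
    refine (lebNorm_sum_le _ _).trans ((Finset.sum_le_card_nsmul _ _ _ hbox).trans ?_)
    rw [card_nbhd, nsmul_eq_mul]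
    simp [N]
  have hlebt : lebNorm p (Lp.toTemperedDistribution vt) < ∞ := by
    refine hleb.trans_lt ?_
    have h3 := weight_ne_top (-α) k
    have h4 := weight_ne_top (α + δ) k
    have h5 : ‖g‖ₑ ≠ ∞ := enorm_ne_top
    have h6 : D ≠ ∞ := ENNReal.ofReal_ne_top
    finiteness
  obtain ⟨gp, hgp⟩ := exists_of_lebNorm_lt_top hlebt
  rw [← hvt, Lp.inner_fourier_eq]
  refine (enorm_inner_le hpp' hgp hh).trans ?_
  rw [← lebNorm_toTemperedDistribution gp, hgp]
  calc _ ≤ N * (W * weight (-α) k * (A * D * (C * (weight (α + δ) k * ‖g‖ₑ)))) * ‖h‖ₑ := by gcongr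
    -- The order `α` cancels between the two weights at `k`, leaving only the loss `δ`.
    _ = N * (W * (A * C)) * (weight (-α) k * weight (α + δ) k) * D * (‖g‖ₑ * ‖h‖ₑ) := by ring
    _ = _ := by
      rw [← weight_add, neg_add_cancel_left]
      push_cast
      ring

end Dispersive

end ModulationSpace

end

noncomputable section

namespace ModulationSpace

variable {n : ℕ} {ρ : Euc n → ℝ}

/-! ### From `L^a` to `L²` by continuous linear maps -/

section LocalOperators

/-- The `L²` representative of `□_k g` is unique, so choosing it is linear in `g`. A continuous
linear map is wanted because it preserves strong measurability in time. -/
theorem IsGenerator.exists_boxCLM (hρ : IsGenerator ρ) {a : ℝ≥0∞} [Fact (1 ≤ a)] (h1 : 1 < a)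
    (h2 : a ≤ 2) :
    ∃ C : ℝ≥0, ∀ k : Fin n → ℤ, ∃ B : Lp ℂ a (volume : Measure (Euc n)) →L[ℂ] L2 n,
      (∀ g, Lp.toTemperedDistribution (B g) = box ρ k (Lp.toTemperedDistribution g)) ∧
        ∀ g, ‖B g‖ₑ ≤ C * ‖g‖ₑ := by
  obtain ⟨C, hC⟩ := exists_box_bound hρ h1 h2
  refine ⟨C, fun k => ?_⟩
  choose B hB hBle using fun g => (hC k g).2
  let D : 𝓢'(Euc n, ℂ) →L[ℂ] 𝓢'(Euc n, ℂ) :=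
    TemperedDistribution.fourierMultiplierCLM ℂ (fun ξ => (sigma ρ k ξ : ℂ))
  let T := Lp.toTemperedDistributionCLM ℂ (volume : Measure (Euc n)) a
  let T2 := Lp.toTemperedDistributionCLM ℂ (volume : Measure (Euc n)) 2
  have hB' : ∀ g, T2 (B g) = D (T g) := hB
  have hinj : Function.Injective T2 := toTemperedDistribution_injective
  let Bl : Lp ℂ a (volume : Measure (Euc n)) →ₗ[ℂ] L2 n :=
    { toFun := B
      map_add' := fun g h => hinj (by rw [map_add, hB', hB', hB', map_add, map_add])
      map_smul' := fun c g => hinj (by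
        rw [RingHom.id_apply, map_smul, hB', hB', map_smul, map_smul]) }
  refine ⟨Bl.mkContinuous C fun g => ?_, hB, hBle⟩
  have := hBle g
  rw [← ofReal_norm, ← ofReal_norm, ← ENNReal.ofReal_coe_nnreal,
    ← ENNReal.ofReal_mul C.coe_nonneg] at this
  exact (ENNReal.ofReal_le_ofReal_iff (by positivity)).1 this

/-- Functions of `L^a`, `1 < a ≤ 2`, that are localized in frequency near `k` belong to `L^2`. -/
theorem IsGenerator.exists_localCLM (hρ : IsGenerator ρ) {a : ℝ≥0∞} [Fact (1 ≤ a)] (h1 : 1 < a)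
    (h2 : a ≤ 2) :
    ∃ C : ℝ≥0, ∀ k : Fin n → ℤ, ∃ B : Lp ℂ a (volume : Measure (Euc n)) →L[ℂ] L2 n,
      (∀ (g : Lp ℂ a (volume : Measure (Euc n))) (u : 𝓢'(Euc n, ℂ)),
        Lp.toTemperedDistribution g = box ρ k u → Lp.toTemperedDistribution (B g) = box ρ k u) ∧
          ∀ g, ‖B g‖ₑ ≤ C * ‖g‖ₑ := by
  obtain ⟨C, hC⟩ := hρ.exists_boxCLM h1 h2
  choose B hB hBle using hC
  -- The sum of the `□_l` over `nbhd k`, rather than `□_k` alone, since it must act as the identity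
  -- on functions of the form `□_k u`.
  refine ⟨(nbhd (0 : Fin n → ℤ)).card * C, fun k => ⟨∑ l ∈ nbhd k, B l, ?_, ?_⟩⟩
  · intro g u hg
    rw [_root_.sum_apply, toTemperedDistribution_sum]
    simp only [hB, hg]
    exact hρ.sum_box_box k u
  · intro g
    rw [_root_.sum_apply]
    refine (enorm_sum_le _ _).trans ((Finset.sum_le_card_nsmul _ _ _ fun l _ => hBle l g).trans ?_)
    rw [card_nbhd, nsmul_eq_mul]
    push_cast
    rw [mul_assoc]

end LocalOperators

/-! ### Bochner integrals of series, and squares of integrals -/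

section BochnerIntegral

/-- Tonelli: the series of norms is integrable on each `[-T, T]`, hence finite almost everywhere
there, and it dominates the norm of the sum. -/
theorem ae_summable_and_intervalIntegrable_tsum {ι X : Type*} [Countable ι] [NormedAddCommGroup X]
    [CompleteSpace X] {h : ι → ℝ → X} (hm : ∀ i, AEStronglyMeasurable (h i) volume)
    (hfin : ∀ T : ℝ, ∑' i, ∫⁻ t in Set.Icc (-T) T, ‖h i t‖ₑ ≠ ∞) :
    (∀ᵐ t : ℝ, Summable fun i => h i t) ∧
      ∀ a b : ℝ, IntervalIntegrable (fun t => ∑' i, h i t) volume a b := by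
  have hfin' : ∀ T : ℝ, ∫⁻ t in Set.Icc (-T) T, ∑' i, ‖h i t‖ₑ ≠ ∞ := fun T => by
    rw [lintegral_tsum fun i => (hm i).enorm.restrict]
    exact hfin T
  constructor
  · have h1 : ∀ T : ℕ, ∀ᵐ t : ℝ, t ∈ Set.Icc (-(T : ℝ)) T → ∑' i, ‖h i t‖ₑ < ∞ := fun T => by
      rw [← ae_restrict_iff' measurableSet_Icc]
      exact ae_lt_top' (AEMeasurable.tsum fun i => (hm i).enorm.restrict) (hfin' T)
    filter_upwards [ae_all_iff.2 h1] with t ht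
    obtain ⟨T, hT⟩ := exists_nat_ge |t|
    exact Summable.of_enorm (ht T (abs_le.1 hT)).ne
  · intro a b
    rw [intervalIntegrable_iff]
    refine ⟨(AEStronglyMeasurable.tsum hm).restrict, ?_⟩
    set T : ℝ := max |a| |b|
    have hsub : Set.uIoc a b ⊆ Set.Icc (-T) T := by
      refine Set.uIoc_subset_uIcc.trans (Set.uIcc_subset_Icc ?_ ?_)
      · exact abs_le.1 (le_max_left _ _)
      · exact abs_le.1 (le_max_right _ _)
    calc ∫⁻ t in Set.uIoc a b, ‖∑' i, h i t‖ₑ ≤ ∫⁻ t in Set.Icc (-T) T, ‖∑' i, h i t‖ₑ :=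
          lintegral_mono_set hsub
      _ ≤ ∫⁻ t in Set.Icc (-T) T, ∑' i, ‖h i t‖ₑ := lintegral_mono fun t => enorm_tsum_le_tsum_enorm
      _ < ∞ := (hfin' T).lt_top

/-- The `T T*` expansion: both slots of `⟨I, I⟩` are written as integrals. A non-integrable `h` has
integral `0` by convention. -/
theorem enorm_integral_sq_le_lintegral_inner {α X : Type*} [MeasurableSpace α] {ν : Measure α}
    [NormedAddCommGroup X] [InnerProductSpace ℂ X] [CompleteSpace X] (h : α → X) :
    ‖∫ x, h x ∂ν‖ₑ ^ 2 ≤ ∫⁻ x, ∫⁻ y, ‖(inner ℂ (h x) (h y) : ℂ)‖ₑ ∂ν ∂ν := by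
  by_cases hh : Integrable h ν
  swap
  · simp [integral_undef hh]
  set I := ∫ x, h x ∂ν with hI
  have h1 : ‖I‖ₑ ^ 2 = ‖(inner ℂ I I : ℂ)‖ₑ := by
    rw [inner_self_eq_norm_sq_to_K, enorm_pow, ← ofReal_norm, ← ofReal_norm]
    simp
  have h2 : ∀ x, ‖(inner ℂ I (h x) : ℂ)‖ₑ ≤ ∫⁻ y, ‖(inner ℂ (h x) (h y) : ℂ)‖ₑ ∂ν := by
    intro x
    have : ‖(inner ℂ I (h x) : ℂ)‖ₑ = ‖(inner ℂ (h x) I : ℂ)‖ₑ := by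
      rw [← ofReal_norm, norm_inner_symm, ofReal_norm]
    rw [this, hI, ← integral_inner hh]
    exact enorm_integral_le_lintegral_enorm _
  rw [h1]
  conv_lhs => rw [hI, ← hI, ← integral_inner hh]
  exact (enorm_integral_le_lintegral_enorm _).trans (lintegral_mono h2)

end BochnerIntegral

/-! ### Damping by powers of `1 + |ξ|²` -/

section Japanese

/-- The weight `(1 + |ξ|²)^M`. -/
def japanese (M : ℝ) (ξ : Euc n) : ℂ := (((1 + ‖ξ‖ ^ 2) ^ M : ℝ) : ℂ)

theorem hasTemperateGrowth_japanese (M : ℝ) : (japanese (n := n) M).HasTemperateGrowth := by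
  unfold japanese
  fun_prop

theorem japanese_neg_mul_japanese (M : ℝ) (ξ : Euc n) : japanese (-M) ξ * japanese M ξ = 1 := by
  rw [japanese, japanese, ← Complex.ofReal_mul, ← Real.rpow_add (by positivity)]
  simp

theorem norm_japanese (M : ℝ) (ξ : Euc n) : ‖japanese M ξ‖ = (1 + ‖ξ‖ ^ 2) ^ M := by
  rw [japanese, Complex.norm_real, Real.norm_eq_abs, abs_of_nonneg (by positivity)]

theorem norm_japanese_neg_le (M : ℝ) (hM : 0 ≤ M) (ξ : Euc n) :
    ‖japanese (-M) ξ‖ ≤ 2 ^ M * (1 + ‖ξ‖) ^ (-(2 * M)) := by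
  rw [norm_japanese, Real.rpow_neg (by positivity), Real.rpow_neg (by positivity),
    ← div_eq_mul_inv, inv_eq_one_div, div_le_div_iff₀ (by positivity) (by positivity), one_mul,
    ← Real.mul_rpow (by positivity) (by positivity), mul_comm 2 M, mul_comm M 2,
    Real.rpow_mul (by positivity)]
  refine Real.rpow_le_rpow (by positivity) ?_ hM
  rw [Real.rpow_ofNat]
  nlinarith [sq_nonneg (‖ξ‖ - 1)]

theorem memLp_japanese_neg {M : ℝ} (hM : 0 ≤ M) :
    MemLp (japanese (n := n) (-M)) ∞ (volume : Measure (Euc n)) := by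
  refine memLp_top_of_hasTemperateGrowth (hasTemperateGrowth_japanese _) (C := 1) fun ξ => ?_
  rw [norm_japanese]
  exact Real.rpow_le_one_of_one_le_of_nonpos (by nlinarith [sq_nonneg ‖ξ‖]) (by linarith)

/-- Where `σ_l` with `l` in `nbhd k` is nonzero one has `|ξ - k| ≤ 3 √n`, so the damping factor is
at most a constant times `(1 + |k|)^{-2M}`. This decay makes the pieces summable in `k`. -/
theorem IsGenerator.exists_enorm_mulL2_japanese_le (hρ : IsGenerator ρ) {M : ℝ} (hM : 0 ≤ M) :
    ∃ C : ℝ≥0, ∀ (k : Fin n → ℤ) (F : L2 n), ∑ l ∈ nbhd k, mulL2 (sigmaC ρ l) F = F →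
      ‖mulL2 (japanese (-M)) F‖ₑ ≤ C * (weight (-(2 * M)) k * ‖F‖ₑ) := by
  set c : ℝ := 2 ^ M * (1 + 3 * √(n : ℝ)) ^ |-(2 * M)|
  have hc : 0 ≤ c := by positivity
  refine ⟨(nbhd (0 : Fin n → ℤ)).card * c.toNNReal, fun k F hF => ?_⟩
  have hterm : ∀ l ∈ nbhd k, ‖mulL2 (japanese (-M)) (mulL2 (sigmaC ρ l) F)‖ₑ ≤
      ENNReal.ofReal c * (weight (-(2 * M)) k * ‖F‖ₑ) := by
    intro l hl
    rw [mulL2_mulL2 (memLp_japanese_neg hM) (hρ.memLp_sigmaC l), weight, ← ofReal_norm,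
      ← ofReal_norm, ← ENNReal.ofReal_mul (by positivity), ← ENNReal.ofReal_mul hc, ← mul_assoc]
    refine ENNReal.ofReal_le_ofReal (norm_mulL2_le
      ((hρ.memLp_sigmaC l).mul (memLp_japanese_neg hM)) (fun ξ => ?_) F)
    rcases eq_or_ne (sigma ρ l ξ) 0 with h0 | h0
    · have h1 : sigmaC ρ l ξ = 0 := by simp [sigmaC, h0]
      rw [Pi.mul_apply, h1, mul_zero, norm_zero]
      positivity
    · have h1 := hρ.norm_sub_lt_of_sigma_ne_zero h0
      have h2 := mem_nbhd.1 hl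
      have h3 : ‖ξ - latticePt k‖ ≤ 3 * √(n : ℝ) := by
        calc ‖ξ - latticePt k‖ = ‖(ξ - latticePt l) + (latticePt l - latticePt k)‖ := by abel_nf
          _ ≤ _ := norm_add_le _ _
          _ ≤ _ := by linarith
      calc ‖japanese (-M) ξ * sigmaC ρ l ξ‖ ≤ ‖japanese (-M) ξ‖ * 1 := by
            rw [norm_mul]
            gcongr
            exact hρ.norm_sigmaC_le l ξ
        _ ≤ 2 ^ M * ((1 + 3 * √(n : ℝ)) ^ |-(2 * M)| * (1 + ‖latticePt k‖) ^ (-(2 * M))) := by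
            rw [mul_one]
            refine (norm_japanese_neg_le M hM ξ).trans ?_
            gcongr
            exact one_add_norm_rpow_le _ (by positivity) h3
        _ = _ := by simp only [c]; ring
  calc ‖mulL2 (japanese (-M)) F‖ₑ
      = ‖∑ l ∈ nbhd k, mulL2 (japanese (-M)) (mulL2 (sigmaC ρ l) F)‖ₑ := by
        rw [← map_sum, hF]
    _ ≤ (nbhd k).card • (ENNReal.ofReal c * (weight (-(2 * M)) k * ‖F‖ₑ)) :=
        (enorm_sum_le _ _).trans (Finset.sum_le_card_nsmul _ _ _ hterm)
    _ = _ := by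
        rw [card_nbhd, nsmul_eq_mul]
        push_cast
        rw [mul_assoc]
        rfl

end Japanese

/-! ### Reassembling a distribution from its frequency pieces -/

section FourierRepresentation

/-- Against a compactly supported test function only finitely many `σ_k` matter, and they add up to
`1` on its support; density gives the rest. Hence the Fourier transform of `u` is a function, as
`IsPropagated` requires. -/
theorem IsGenerator.hasSum_toTemperedDistribution (hρ : IsGenerator ρ) {M : ℝ} (hM : 0 ≤ M)
    {F : (Fin n → ℤ) → L2 n} {u : 𝓢'(Euc n, ℂ)}
    (hF : ∀ k, Lp.toTemperedDistribution (F k) = 𝓕 (box ρ k u))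
    (hs : Summable fun k => mulL2 (japanese (-M)) (F k)) :
    𝓕 u = TemperedDistribution.smulLeftCLM ℂ (japanese M)
      (Lp.toTemperedDistribution (∑' k, mulL2 (japanese (-M)) (F k))) := by
  set H : L2 n := ∑' k, mulL2 (japanese (-M)) (F k)
  have hJ := hasTemperateGrowth_japanese (n := n) (-M)
  have key : Lp.toTemperedDistribution H =
      TemperedDistribution.smulLeftCLM ℂ (japanese (-M)) (𝓕 u) := by
    refine temperedDistribution_ext_of_hasCompactSupport fun ψ hψ => ?_
    let L : L2 n →L[ℂ] ℂ := (PointwiseConvergenceCLM.evalCLM (RingHom.id ℂ) ℂ ψ).comp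
      (Lp.toTemperedDistributionCLM ℂ (volume : Measure (Euc n)) 2)
    have h1 : HasSum (fun k => L (mulL2 (japanese (-M)) (F k))) (L H) := L.hasSum hs.hasSum
    have hterm : ∀ k, L (mulL2 (japanese (-M)) (F k)) =
        (𝓕 u) (SchwartzMap.smulLeftCLM ℂ (sigmaC ρ k)
          (SchwartzMap.smulLeftCLM ℂ (japanese (-M)) ψ)) := by
      intro k
      change Lp.toTemperedDistribution (mulL2 (japanese (-M)) (F k)) ψ = _
      rw [toTemperedDistribution_mulL2 hJ (memLp_japanese_neg hM), hF, fourier_box,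
        TemperedDistribution.smulLeftCLM_apply_apply, TemperedDistribution.smulLeftCLM_apply_apply]
    obtain ⟨R, hR⟩ := hψ.isCompact.isBounded.subset_closedBall (0 : Euc n)
    set S := (finite_norm_sub_latticePt_le (0 : Euc n) (R + √(n : ℝ))).toFinset
    have hS : ∀ ξ, ψ ξ ≠ 0 → ∀ k ∉ S, sigma ρ k ξ = 0 := by
      intro ξ hξ k hk
      have h2 : ‖ξ‖ ≤ R := by simpa using hR (subset_tsupport _ hξ)
      refine hρ.sigma_eq_zero ?_
      simp only [S, Set.Finite.mem_toFinset, Set.mem_ofPred_eq, not_le, zero_sub, norm_neg] at hk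
      have : ‖latticePt k‖ ≤ ‖ξ‖ + ‖ξ - latticePt k‖ := by
        calc ‖latticePt k‖ = ‖ξ - (ξ - latticePt k)‖ := by abel_nf
          _ ≤ _ := norm_sub_le _ _
      linarith
    have hz : ∀ k ∉ S, L (mulL2 (japanese (-M)) (F k)) = 0 := by
      intro k hk
      rw [hterm k]
      have : SchwartzMap.smulLeftCLM ℂ (sigmaC ρ k)
          (SchwartzMap.smulLeftCLM ℂ (japanese (-M)) ψ) = 0 := by
        ext ξ
        rw [SchwartzMap.smulLeftCLM_apply_apply (hρ.hasTemperateGrowth_sigmaC k),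
          SchwartzMap.smulLeftCLM_apply_apply hJ]
        rcases eq_or_ne (ψ ξ) 0 with h | h
        · simp [h]
        · simp [sigmaC, hS ξ h k hk]
      rw [this, map_zero]
    have hsum : L H = ∑ k ∈ S, L (mulL2 (japanese (-M)) (F k)) :=
      h1.unique (hasSum_sum_of_ne_finset_zero hz)
    change L H = _
    rw [hsum, TemperedDistribution.smulLeftCLM_apply_apply]
    simp only [hterm]
    rw [← map_sum]
    congr 1
    ext ξ
    rw [_root_.sum_apply]
    simp only [SchwartzMap.smulLeftCLM_apply_apply (hρ.hasTemperateGrowth_sigmaC _),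
      SchwartzMap.smulLeftCLM_apply_apply hJ, smul_eq_mul]
    rw [← Finset.sum_mul]
    rcases eq_or_ne (ψ ξ) 0 with h | h
    · simp [h]
    · have : ∑ k ∈ S, sigmaC ρ k ξ = 1 := by
        simp only [sigmaC]
        rw [← Complex.ofReal_sum, hρ.sum_sigma_eq_one (hS ξ h), Complex.ofReal_one]
      rw [this, one_mul]
  rw [key, TemperedDistribution.smulLeftCLM_smulLeftCLM_apply hJ (hasTemperateGrowth_japanese M)]
  have : (japanese (-M) * japanese M : Euc n → ℂ) = fun _ => 1 :=
    funext fun ξ => japanese_neg_mul_japanese M ξ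
  rw [this, TemperedDistribution.smulLeftCLM_const]
  ext φ
  simp

end FourierRepresentation

end ModulationSpace

end

noncomputable section

namespace ModulationSpace

variable {n : ℕ} {ρ P : Euc n → ℝ}

/-! ### Existence of the Duhamel integral -/

section Duhamel

section ContinuousFamily

variable {X : Type*} [NormedAddCommGroup X] {Φ : ℝ → X → X}

theorem intervalIntegrable_family_neg (hΦ : Continuous fun z : ℝ × X => Φ z.1 z.2)
    (hn : ∀ t x, ‖Φ t x‖ = ‖x‖) {h : ℝ → X} {a b : ℝ} (hh : IntervalIntegrable h volume a b) :
    IntervalIntegrable (fun τ => Φ (-τ) (h τ)) volume a b := by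
  rw [intervalIntegrable_iff] at hh ⊢
  exact Integrable.congr' hh
    (hΦ.comp_aestronglyMeasurable (continuous_neg.aestronglyMeasurable.prodMk hh.1))
    (ae_of_all _ fun τ => (hn (-τ) (h τ)).symm)

theorem continuous_family_primitive [NormedSpace ℝ X]
    (hΦ : Continuous fun z : ℝ × X => Φ z.1 z.2) (hn : ∀ t x, ‖Φ t x‖ = ‖x‖) {h : ℝ → X}
    (hh : ∀ a b, IntervalIntegrable h volume a b) :
    Continuous fun t => Φ t (∫ τ in (0 : ℝ)..t, Φ (-τ) (h τ)) :=
  hΦ.comp (continuous_id.prodMk (intervalIntegral.continuous_primitive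
    (fun a b => intervalIntegrable_family_neg hΦ hn (hh a b)) 0))

end ContinuousFamily

/-- The Duhamel integral `∫_0^t e^{i(t-τ)P} h(τ) dτ` on the Fourier side. -/
def duhamel (P : Euc n → ℝ) (h : ℝ → L2 n) (t : ℝ) : L2 n :=
  prop P t (∫ τ in (0 : ℝ)..t, prop P (-τ) (h τ))

theorem intervalIntegrable_prop_neg (hP : AEMeasurable P) {h : ℝ → L2 n} {a b : ℝ}
    (hh : IntervalIntegrable h volume a b) :
    IntervalIntegrable (fun τ => prop P (-τ) (h τ)) volume a b :=
  intervalIntegrable_family_neg (Φ := fun t f => prop P t f) (continuous_prop hP) (norm_prop hP) hh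

theorem continuous_duhamel (hP : AEMeasurable P) {h : ℝ → L2 n}
    (hh : ∀ a b, IntervalIntegrable h volume a b) : Continuous (duhamel P h) :=
  continuous_family_primitive (Φ := fun t f => prop P t f) (continuous_prop hP) (norm_prop hP) hh

theorem duhamel_eq_intervalIntegral (hP : AEMeasurable P) {h : ℝ → L2 n} {t : ℝ}
    (hh : IntervalIntegrable h volume 0 t) :
    duhamel P h t = ∫ τ in (0 : ℝ)..t, prop P (t - τ) (h τ) := by
  rw [duhamel, ← ContinuousLinearMap.intervalIntegral_comp_comm _
    (intervalIntegrable_prop_neg hP hh)]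
  simp only [prop_prop hP, sub_eq_add_neg]

/-- Multipliers commute with the propagator and with the Bochner integral, so `□_k` can be moved
inside the Duhamel integral. -/
theorem mulL2_duhamel (hP : AEMeasurable P) {h : ℝ → L2 n} {t : ℝ}
    (hh : IntervalIntegrable h volume 0 t) {m : Euc n → ℂ}
    (hm : MemLp m ∞ (volume : Measure (Euc n))) :
    mulL2 m (duhamel P h t) = duhamel P (fun τ => mulL2 m (h τ)) t := by
  rw [duhamel, prop, mulL2_comm hm (memLp_propSymbol hP t),
    ← ContinuousLinearMap.intervalIntegral_comp_comm _ (intervalIntegrable_prop_neg hP hh)]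
  simp only [prop, mulL2_comm hm (memLp_propSymbol hP _), duhamel]

theorem duhamel_congr_ae {h h' : ℝ → L2 n} (hh : h =ᵐ[volume] h') (t : ℝ) :
    duhamel P h t = duhamel P h' t := by
  rw [duhamel, duhamel]
  congr 1
  refine intervalIntegral.integral_congr_ae ?_
  filter_upwards [hh] with τ hτ _
  rw [hτ]

/-- Moving the growing symbol `J` onto the test function makes the pairing with `φ` a continuous
functional of the `L²` factor; the weak integral is then the image of a Bochner integral in `L²`. -/
theorem isDuhamel_of_fourier_eq (hP : AEMeasurable P) {J : Euc n → ℂ} (hJ : J.HasTemperateGrowth)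
    {f : ℝ → 𝓢'(Euc n, ℂ)} {h : ℝ → L2 n} (hh : ∀ a b, IntervalIntegrable h volume a b)
    (hf : ∀ᵐ τ : ℝ, 𝓕 (f τ) =
      TemperedDistribution.smulLeftCLM ℂ J (Lp.toTemperedDistribution (h τ))) :
    IsDuhamel P f fun t => 𝓕⁻ (TemperedDistribution.smulLeftCLM ℂ J
      (Lp.toTemperedDistribution (duhamel P h t))) := by
  intro t
  refine ⟨fun τ => 𝓕⁻ (TemperedDistribution.smulLeftCLM ℂ J
      (Lp.toTemperedDistribution (prop P (t - τ) (h τ)))), ?_, fun φ => ?_⟩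
  · filter_upwards [hf] with τ hτ _
    exact isPropagated_fourierInv_smulLeft hP hJ (t - τ) (h τ) hτ (fourier_fourierInv_eq _)
  · let L : L2 n →L[ℂ] ℂ :=
      (PointwiseConvergenceCLM.evalCLM (RingHom.id ℂ) ℂ (SchwartzMap.smulLeftCLM ℂ J (𝓕⁻ φ))).comp
        (Lp.toTemperedDistributionCLM ℂ (volume : Measure (Euc n)) 2)
    have hL : ∀ g : L2 n, (𝓕⁻ (TemperedDistribution.smulLeftCLM ℂ J
        (Lp.toTemperedDistribution g))) φ = L g := fun g => rfl
    simp only [hL]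
    have hint : IntervalIntegrable (fun τ => prop P (t - τ) (h τ)) volume 0 t := by
      have h1 := intervalIntegrable_prop_neg hP (hh 0 t)
      rw [intervalIntegrable_iff] at h1 ⊢
      refine ((prop P t).integrable_comp h1).congr (ae_of_all _ fun τ => ?_)
      simp only [prop_prop hP, sub_eq_add_neg]
    refine ⟨?_, ?_⟩
    · rw [intervalIntegrable_iff] at hint ⊢
      exact L.integrable_comp hint
    · rw [duhamel_eq_intervalIntegral hP (hh 0 t), L.intervalIntegral_comp_comm hint]

/-- The Duhamel integral of `f` exists as soon as the pieces `□_k f` are summable in a weighted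
sense; it can be computed piecewise. -/
theorem IsGenerator.exists_isDuhamel (hρ : IsGenerator ρ) (hP : AEMeasurable P) {M : ℝ}
    (hM : 0 ≤ M) {f : ℝ → 𝓢'(Euc n, ℂ)} {F : (Fin n → ℤ) → ℝ → L2 n}
    (hm : ∀ k, AEStronglyMeasurable (F k) volume)
    (hF : ∀ k, ∀ᵐ τ : ℝ, Lp.toTemperedDistribution (F k τ) = 𝓕 (box ρ k (f τ)))
    (hfin : ∀ T : ℝ, ∑' k, ∫⁻ τ in Set.Icc (-T) T, ‖mulL2 (japanese (-M)) (F k τ)‖ₑ ≠ ∞) :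
    ∃ u : ℝ → 𝓢'(Euc n, ℂ), IsDuhamel P f u ∧ ∀ k, Continuous (duhamel P (F k)) ∧
      ∀ t, box ρ k (u t) = Lp.toTemperedDistribution (𝓕⁻ (duhamel P (F k) t)) := by
  obtain ⟨hsum, hint⟩ := ae_summable_and_intervalIntegrable_tsum
    (h := fun k τ => mulL2 (japanese (-M)) (F k τ))
    (fun k => (mulL2 (japanese (-M))).continuous.comp_aestronglyMeasurable (hm k)) hfin
  set H : ℝ → L2 n := fun τ => ∑' k, mulL2 (japanese (-M)) (F k τ)
  have hJ := hasTemperateGrowth_japanese (n := n) M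
  have hf : ∀ᵐ τ : ℝ, 𝓕 (f τ) = TemperedDistribution.smulLeftCLM ℂ (japanese M)
      (Lp.toTemperedDistribution (H τ)) := by
    filter_upwards [hsum, ae_all_iff.2 hF] with τ h1 h2
    exact hρ.hasSum_toTemperedDistribution hM h2 h1
  refine ⟨_, isDuhamel_of_fourier_eq hP hJ hint hf, fun k => ?_⟩
  -- The factor `japanese M` may be unbounded, but its product with `σ_k` has compact support and so
  -- is a bounded multiplier. It recovers the piece `F k` from the damped sum `H`.
  set m : Euc n → ℂ := japanese M * sigmaC ρ k
  have hmt : m.HasTemperateGrowth := hJ.mul (hρ.hasTemperateGrowth_sigmaC k)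
  have hmp : MemLp m ∞ (volume : Measure (Euc n)) := by
    have hc : HasCompactSupport m := (hρ.hasCompactSupport_sigmaC k).mul_left
    obtain ⟨C, hC⟩ := hmt.1.continuous.bounded_above_of_compact_support hc
    exact memLp_top_of_hasTemperateGrowth hmt hC
  have hmul : ∀ g : L2 n, Lp.toTemperedDistribution (mulL2 m g) =
      TemperedDistribution.smulLeftCLM ℂ (sigmaC ρ k)
        (TemperedDistribution.smulLeftCLM ℂ (japanese M) (Lp.toTemperedDistribution g)) := by
    intro g
    rw [toTemperedDistribution_mulL2 hmt hmp, TemperedDistribution.smulLeftCLM_smulLeftCLM_apply hJ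
      (hρ.hasTemperateGrowth_sigmaC k)]
  have hFH : (fun τ => mulL2 m (H τ)) =ᵐ[volume] F k := by
    filter_upwards [hf, hF k] with τ h1 h2
    apply toTemperedDistribution_injective
    rw [hmul, ← h1, h2, fourier_box]
  have hFi : ∀ a b, IntervalIntegrable (F k) volume a b := fun a b => by
    have h1 := hint a b
    rw [intervalIntegrable_iff] at h1 ⊢
    exact ((mulL2 m).integrable_comp h1).congr (ae_restrict_of_ae hFH)
  refine ⟨continuous_duhamel hP hFi, fun t => ?_⟩
  rw [← Lp.fourierInv_toTemperedDistribution_eq, ← duhamel_congr_ae hFH,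
    ← mulL2_duhamel hP (hint 0 t) hmp, hmul, box_eq, fourier_fourierInv_eq]

end Duhamel

end ModulationSpace

end

noncomputable section

namespace ModulationSpace

variable {n : ℕ} {ρ P : Euc n → ℝ}

/-! ### The `T T*` estimate on a single frequency piece -/

section Energy

theorem inner_prop_neg_prop_neg (hP : AEMeasurable P) (x y : ℝ) (f g : L2 n) :
    inner ℂ (prop P (-x) f) (prop P (-y) g) = inner ℂ f (prop P (x - y) g) := by
  rw [← inner_prop_prop hP x, prop_prop hP, prop_prop hP, add_neg_cancel, prop_zero hP,
    sub_eq_add_neg]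

/-- Unitarity removes the outer `e^{itP}`, and positivity allows the time interval to be enlarged to
`ℝ`; the bound thus no longer depends on `t`. -/
theorem enorm_duhamel_sq_le (hP : AEMeasurable P) (h : ℝ → L2 n) (t : ℝ) :
    ‖duhamel P h t‖ₑ ^ 2 ≤ ∫⁻ x, ∫⁻ y, ‖(inner ℂ (h x) (prop P (x - y) (h y)) : ℂ)‖ₑ := by
  have h1 : ‖duhamel P h t‖ₑ = ‖∫ τ in Set.uIoc 0 t, prop P (-τ) (h τ)‖ₑ := by
    rw [duhamel, ← ofReal_norm, norm_prop hP, intervalIntegral.norm_intervalIntegral_eq,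
      ofReal_norm]
  rw [h1]
  refine (enorm_integral_sq_le_lintegral_inner _).trans ?_
  simp only [inner_prop_neg_prop_neg hP]
  exact (setLIntegral_le_lintegral _ _).trans
    (lintegral_mono fun x => setLIntegral_le_lintegral _ _)

/-- The core estimate: the `T T*` bound, then the localized dispersive estimate, then
Hardy-Littlewood-Sobolev for `τ ↦ ‖g τ‖`. Everything is squared, hence the weight of order `δ / 2`
and the constant `√(C₁ C₂)`. -/
theorem IsGenerator.exists_enorm_duhamel_le (hρ : IsGenerator ρ) (hP : AEMeasurable P)
    {p p' : ℝ≥0∞} [Fact (1 ≤ p)] [Fact (1 ≤ p')] (hpp' : p.HolderConjugate p') (h1 : 1 < p')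
    (h2 : p' ≤ 2) {q : ℝ} (hq : 0 < q) {α δ μ : ℝ} (hμ0 : 0 < μ) (hμ1 : μ < 1)
    (hU : DispersiveEstimate ρ P p p' q α δ μ) {r : ℝ} (hr : r * (2 - μ) = 2) :
    ∃ C : ℝ≥0, ∀ (k : Fin n → ℤ) (f : ℝ → 𝓢'(Euc n, ℂ)) (v : ℝ → L2 n)
      (g : ℝ → Lp ℂ p' (volume : Measure (Euc n))), AEStronglyMeasurable g volume →
      (∀ᵐ τ : ℝ, Lp.toTemperedDistribution (v τ) = box ρ k (f τ)) →
      (∀ᵐ τ : ℝ, Lp.toTemperedDistribution (g τ) = box ρ k (f τ)) →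
      ∀ t, ‖duhamel P (fun τ => 𝓕 (v τ)) t‖ₑ ≤
        C * (weight (δ / 2) k * (∫⁻ τ, ‖g τ‖ₑ ^ r) ^ (1 / r)) := by
  obtain ⟨C₁, hC₁⟩ := hρ.exists_enorm_inner_prop_le hP hpp' h1 h2 hq hU
  obtain ⟨C₂, hC₂⟩ := hardy_littlewood_sobolev_diagonal hμ0 hμ1 hr
  refine ⟨NNReal.sqrt (C₁ * C₂), fun k f v g hg hv hgf t => ?_⟩
  have hw : weight δ k = weight (δ / 2) k ^ 2 := by rw [sq, ← weight_add, add_halves]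
  have hs : ((NNReal.sqrt (C₁ * C₂) : ℝ≥0) : ℝ≥0∞) ^ 2 = C₁ * C₂ := by
    rw [← ENNReal.coe_pow, NNReal.sq_sqrt, ENNReal.coe_mul]
  rw [← ENNReal.pow_le_pow_left_iff two_ne_zero, mul_pow, mul_pow, hs, ← hw]
  refine (enorm_duhamel_sq_le hP _ t).trans ?_
  have hle : ∀ᵐ x : ℝ, ∀ᵐ y : ℝ, ‖(inner ℂ (𝓕 (v x)) (prop P (x - y) (𝓕 (v y))) : ℂ)‖ₑ ≤
      C₁ * weight δ k * (‖g x‖ₑ * ‖g y‖ₑ * ENNReal.ofReal ((1 + |x - y|) ^ (-μ))) := by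
    filter_upwards [hv, hgf] with x hx1 hx2
    filter_upwards [hv, hgf] with y hy1 hy2
    refine (hC₁ k (x - y) (v y) (v x) (g y) (g x) (f y) hy1 (hy2.trans hy1.symm)
      (hx2.trans hx1.symm)).trans (le_of_eq ?_)
    ring
  calc ∫⁻ x, ∫⁻ y, ‖(inner ℂ (𝓕 (v x)) (prop P (x - y) (𝓕 (v y))) : ℂ)‖ₑ
      ≤ ∫⁻ x, ∫⁻ y, C₁ * weight δ k *
          (‖g x‖ₑ * ‖g y‖ₑ * ENNReal.ofReal ((1 + |x - y|) ^ (-μ))) :=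
        lintegral_mono_ae (hle.mono fun x hx => lintegral_mono_ae hx)
    _ = C₁ * weight δ k *
          ∫⁻ x, ∫⁻ y, ‖g x‖ₑ * ‖g y‖ₑ * ENNReal.ofReal ((1 + |x - y|) ^ (-μ)) := by
        have hc : (C₁ : ℝ≥0∞) * weight δ k ≠ ∞ :=
          ENNReal.mul_ne_top ENNReal.coe_ne_top (weight_ne_top _ _)
        simp only [lintegral_const_mul' _ _ hc]
    _ ≤ C₁ * weight δ k * (C₂ * ((∫⁻ x, ‖g x‖ₑ ^ r) ^ (1 / r)) ^ 2) := by
        gcongr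
        exact hC₂ _ hg.enorm
    _ = _ := by ring

end Energy

/-! ### Comparison of `l_□(L^r)` with `L^r(M)` -/

section Norms

variable {a : ℝ≥0∞} [Fact (1 ≤ a)] {r : ℝ≥0∞} {u : ℝ → 𝓢'(Euc n, ℂ)}

theorem eLpNorm_lebNorm_eq {G : ℝ → Lp ℂ a (volume : Measure (Euc n))}
    (h : ∀ᵐ t : ℝ, Lp.toTemperedDistribution (G t) = u t) :
    eLpNorm (fun t => lebNorm a (u t)) r volume = eLpNorm G r volume := by
  refine eLpNorm_congr_enorm_ae ?_
  filter_upwards [h] with t ht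
  rw [← ht, lebNorm_toTemperedDistribution, enorm_eq_self]

theorem bochnerLebNorm_eq {G : ℝ → Lp ℂ a (volume : Measure (Euc n))}
    (hG : AEStronglyMeasurable G volume)
    (h : ∀ᵐ t : ℝ, Lp.toTemperedDistribution (G t) = u t) :
    bochnerLebNorm r a u = eLpNorm G r volume := by
  rw [bochnerLebNorm, if_pos ⟨G, hG, h⟩, eLpNorm_lebNorm_eq h]

theorem stronglyMeasurableInLp_of_bochnerLebNorm_lt_top (h : bochnerLebNorm r a u < ∞) :
    StronglyMeasurableInLp a u := by
  by_contra hc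
  rw [bochnerLebNorm, if_neg hc] at h
  exact h.ne rfl

theorem weight_mul_bochnerLebNorm_le_lBoxNorm {q : ℝ} (hq : 0 < q) (s : ℝ) (k : Fin n → ℤ) :
    weight s k * bochnerLebNorm r a (fun t => box ρ k (u t)) ≤ lBoxNorm ρ s q r a u := by
  rw [lBoxNorm, one_div, ENNReal.le_rpow_inv_iff hq]
  exact ENNReal.le_tsum (f := fun k =>
    (weight s k * bochnerLebNorm r a fun t => box ρ k (u t)) ^ q) k

theorem stronglyMeasurableInLp_box_of_lBoxNorm_lt_top {q : ℝ} (hq : 0 < q) {s : ℝ}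
    (h : lBoxNorm ρ s q r a u < ∞) (k : Fin n → ℤ) :
    StronglyMeasurableInLp a fun t => box ρ k (u t) := by
  have h1 := (weight_mul_bochnerLebNorm_le_lBoxNorm hq s k).trans_lt h
  refine stronglyMeasurableInLp_of_bochnerLebNorm_lt_top (r := r) ?_
  rcases ENNReal.mul_lt_top_iff.1 h1 with h2 | h2 | h2
  · exact h2.2
  · exact absurd h2 (weight_ne_zero _ _)
  · simp [h2]

/-- For almost every `t` all countably many pieces are bounded by their essential suprema at once.
-/
theorem bochnerModNorm_top_le_lBoxNorm {q : ℝ} (hq : 0 < q) (s : ℝ) :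
    bochnerModNorm ρ ∞ s a q u ≤ lBoxNorm ρ s q ∞ a u := by
  rcases eq_or_ne (lBoxNorm ρ s q ∞ a u) ∞ with h | h
  · rw [h]
    exact le_top
  have hm := stronglyMeasurableInLp_box_of_lBoxNorm_lt_top hq h.lt_top
  rw [bochnerModNorm, if_pos hm, eLpNorm_exponent_top]
  refine eLpNormEssSup_le_of_ae_enorm_bound ?_
  have h1 : ∀ k, ∀ᵐ t : ℝ, lebNorm a (box ρ k (u t)) ≤
      bochnerLebNorm ∞ a fun t => box ρ k (u t) := fun k => by
    rw [bochnerLebNorm, if_pos (hm k), eLpNorm_exponent_top]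
    exact enorm_ae_le_eLpNormEssSup (fun t => lebNorm a (box ρ k (u t))) volume
  filter_upwards [ae_all_iff.2 h1] with t ht
  rw [enorm_eq_self, modNorm, lBoxNorm]
  gcongr with k
  exact ht k

theorem eLpNorm_ofReal_eq {X : Type*} [TopologicalSpace X] [ContinuousENorm X] {r : ℝ} (hr : 0 < r)
    (g : ℝ → X) : eLpNorm g (ENNReal.ofReal r) volume = (∫⁻ t, ‖g t‖ₑ ^ r) ^ (1 / r) := by
  rw [eLpNorm_eq_lintegral_rpow_enorm_toReal (by simpa using hr) ENNReal.ofReal_ne_top,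
    ENNReal.toReal_ofReal hr.le]

/-- Minkowski's inequality with exponent `q / r ≥ 1`, applied to the `r`-th powers of the weighted
norms of the pieces. -/
theorem lBoxNorm_le_bochnerModNorm {q r : ℝ} (hr : 0 < r) (hrq : r ≤ q) (s : ℝ) :
    lBoxNorm ρ s q (ENNReal.ofReal r) a u ≤ bochnerModNorm ρ (ENNReal.ofReal r) s a q u := by
  by_cases hm : ∀ k : Fin n → ℤ, StronglyMeasurableInLp a (fun t => box ρ k (u t))
  swap
  · rw [bochnerModNorm, if_neg hm]
    exact le_top
  rw [bochnerModNorm, if_pos hm, eLpNorm_ofReal_eq hr]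
  choose G hG hGu using hm
  have hq : 0 < q := hr.trans_le hrq
  set g : (Fin n → ℤ) → ℝ → ℝ≥0∞ := fun k t => (weight s k * ‖G k t‖ₑ) ^ r
  have hg : ∀ k, AEMeasurable (g k) volume := fun k =>
    ((hG k).enorm.const_mul _).pow_const r
  have h1 := tsum_lintegral_rpow_le_lintegral_tsum_rpow hg (m := q / r) ((one_le_div hr).2 hrq)
  have hL : lBoxNorm ρ s q (ENNReal.ofReal r) a u =
      ((∑' k, (∫⁻ t, g k t) ^ (q / r)) ^ (1 / (q / r))) ^ (1 / r) := by
    rw [lBoxNorm, ← ENNReal.rpow_mul]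
    have e : 1 / (q / r) * (1 / r) = 1 / q := by field_simp
    rw [e]
    congr 1
    refine tsum_congr fun k => ?_
    rw [bochnerLebNorm_eq (hG k) (hGu k), eLpNorm_ofReal_eq hr]
    simp only [g, ENNReal.mul_rpow_of_nonneg _ _ hr.le]
    rw [lintegral_const_mul' _ _ (ENNReal.rpow_ne_top_of_nonneg hr.le (weight_ne_top _ _)),
      ENNReal.mul_rpow_of_nonneg _ _ hq.le,
      ENNReal.mul_rpow_of_nonneg _ _ (by positivity : 0 ≤ q / r), ← ENNReal.rpow_mul, ← ENNReal.rpow_mul, one_div_mul_eq_div, mul_div_cancel₀ _ hr.ne']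
  have hR : ∫⁻ t, (∑' k, g k t ^ (q / r)) ^ (1 / (q / r)) =
      ∫⁻ t, ‖modNorm ρ s a q (u t)‖ₑ ^ r := by
    refine lintegral_congr_ae ?_
    filter_upwards [ae_all_iff.2 hGu] with t ht
    rw [enorm_eq_self, modNorm, ← ENNReal.rpow_mul]
    have e : 1 / (q / r) = 1 / q * r := by field_simp
    rw [e]
    congr 1
    refine tsum_congr fun k => ?_
    simp only [g]
    rw [← ht k, lebNorm_toTemperedDistribution, ← ENNReal.rpow_mul, mul_div_cancel₀ _ hr.ne']
  rw [hL]
  refine ENNReal.rpow_le_rpow (h1.trans_eq hR) (by positivity)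

end Norms

end ModulationSpace

end

noncomputable section

namespace ModulationSpace

variable {n : ℕ} {ρ P : Euc n → ℝ}

/-! ### Summation over the frequency pieces -/

section InhomogeneousStrichartz

theorem exists_setLIntegral_Icc_le {r : ℝ} (hr : 1 < r) (T : ℝ) :
    ∃ K : ℝ≥0∞, K ≠ ∞ ∧ ∀ a : ℝ → ℝ≥0∞, AEMeasurable a volume →
      ∫⁻ t in Set.Icc (-T) T, a t ≤ K * (∫⁻ t, a t ^ r) ^ (1 / r) := by
  have hc := Real.HolderConjugate.conjExponent hr
  refine ⟨(∫⁻ _ in Set.Icc (-T) T, 1 ^ r.conjExponent) ^ (1 / r.conjExponent), ?_, fun a ha => ?_⟩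
  · have := hc.symm.pos
    refine ENNReal.rpow_ne_top_of_nonneg (by positivity) ?_
    simp
  · have h1 := ENNReal.lintegral_mul_le_Lp_mul_Lq (volume.restrict (Set.Icc (-T) T)) hc
      ha.restrict (g := fun _ => 1) aemeasurable_const
    simp only [Pi.mul_apply, mul_one] at h1
    rw [mul_comm]
    have := hc.pos
    refine h1.trans ?_
    gcongr
    exact Measure.restrict_le_self

theorem weight_neg_abs_le (s : ℝ) (k : Fin n → ℤ) : weight (-|s|) k ≤ weight s k :=
  ENNReal.ofReal_le_ofReal (Real.rpow_le_rpow_of_exponent_le (by simp) (neg_abs_le s))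

/-- The estimate on each piece is uniform in `k`, so it passes to weighted `ℓ^q` norms termwise.
Most of the proof checks the summability needed for existence. -/
theorem IsGenerator.exists_isDuhamel_lBoxNorm_le (hρ : IsGenerator ρ) (hP : AEMeasurable P)
    {p p' : ℝ≥0∞} [Fact (1 ≤ p)] [Fact (1 ≤ p')] (hpp' : p.HolderConjugate p') (h1 : 1 < p')
    (h2 : p' ≤ 2) {q : ℝ} (hq : 0 < q) {α δ μ : ℝ} (hμ0 : 0 < μ) (hμ1 : μ < 1)
    (hU : DispersiveEstimate ρ P p p' q α δ μ) {r : ℝ} (hr : r * (2 - μ) = 2) (s : ℝ) :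
    ∃ C : ℝ≥0, ∀ f : ℝ → 𝓢'(Euc n, ℂ),
      lBoxNorm ρ (s + δ / 2) q (ENNReal.ofReal r) p' f < ∞ →
        ∃ u : ℝ → 𝓢'(Euc n, ℂ), IsDuhamel P f u ∧
          lBoxNorm ρ s q ∞ 2 u ≤ C * lBoxNorm ρ (s + δ / 2) q (ENNReal.ofReal r) p' f := by
  have hr1 : 1 < r := by nlinarith
  have hr0 : 0 < r := by linarith
  obtain ⟨C₁, hC₁⟩ := hρ.exists_enorm_duhamel_le hP hpp' h1 h2 hq hμ0 hμ1 hU hr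
  set σ : ℝ := s + δ / 2
  -- Here `2M = 2n + |σ|`: the part `2n` makes the sum over `ℤⁿ` converge, and `|σ|` absorbs the
  -- weight of order `σ`, whatever its sign.
  set M : ℝ := n + |σ| / 2
  have hM : 0 ≤ M := by positivity
  obtain ⟨C₂, hC₂⟩ := hρ.exists_localCLM h1 h2
  obtain ⟨C₃, hC₃⟩ := hρ.exists_enorm_mulL2_japanese_le hM
  choose B hB hBle using hC₂
  refine ⟨C₁, fun f hf => ?_⟩
  set Λ := lBoxNorm ρ σ q (ENNReal.ofReal r) p' f
  choose G hG hGf using stronglyMeasurableInLp_box_of_lBoxNorm_lt_top hq hf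
  have hN : ∀ k, bochnerLebNorm (ENNReal.ofReal r) p' (fun t => box ρ k (f t)) =
      (∫⁻ t, ‖G k t‖ₑ ^ r) ^ (1 / r) := fun k => by
    rw [bochnerLebNorm_eq (hG k) (hGf k), eLpNorm_ofReal_eq hr0]
  have hv : ∀ k, ∀ᵐ t : ℝ, Lp.toTemperedDistribution (B k (G k t)) = box ρ k (f t) := fun k =>
    (hGf k).mono fun t ht => hB k (G k t) (f t) ht
  have hFm : ∀ k, AEStronglyMeasurable (fun t => 𝓕 (B k (G k t))) volume := fun k =>
    (continuous_fourier.comp (B k).continuous).comp_aestronglyMeasurable (hG k)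
  have hterm : ∀ k, ∀ᵐ t : ℝ, ‖mulL2 (japanese (-M)) (𝓕 (B k (G k t)))‖ₑ ≤
      C₃ * (weight (-(2 * M)) k * (C₂ * ‖G k t‖ₑ)) := fun k => by
    filter_upwards [hv k] with t ht
    refine (hC₃ k _ (hρ.sum_mulL2_sigmaC ht)).trans ?_
    rw [← ofReal_norm (𝓕 (B k (G k t))), Lp.norm_fourier_eq, ofReal_norm]
    gcongr
    exact hBle k _
  have hwN : ∀ k, weight (-(2 * M)) k * (∫⁻ t, ‖G k t‖ₑ ^ r) ^ (1 / r) ≤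
      weight (-(2 * n)) k * Λ := fun k => by
    have e : -(2 * M) = -(2 * n) + -|σ| := by simp only [M]; ring
    rw [e, weight_add, mul_assoc, ← hN]
    gcongr
    refine le_trans ?_ (weight_mul_bochnerLebNorm_le_lBoxNorm hq σ k)
    gcongr
    exact weight_neg_abs_le σ k
  have hfin : ∀ T : ℝ, ∑' k, ∫⁻ t in Set.Icc (-T) T,
      ‖mulL2 (japanese (-M)) (𝓕 (B k (G k t)))‖ₑ ≠ ∞ := fun T => by
    obtain ⟨K, hK, hKle⟩ := exists_setLIntegral_Icc_le hr1 T
    have hle : ∀ k, ∫⁻ t in Set.Icc (-T) T, ‖mulL2 (japanese (-M)) (𝓕 (B k (G k t)))‖ₑ ≤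
        C₃ * C₂ * K * Λ * weight (-(2 * n)) k := fun k => by
      calc ∫⁻ t in Set.Icc (-T) T, ‖mulL2 (japanese (-M)) (𝓕 (B k (G k t)))‖ₑ
          ≤ ∫⁻ t in Set.Icc (-T) T, C₃ * weight (-(2 * M)) k * C₂ * ‖G k t‖ₑ :=
            lintegral_mono_ae (ae_restrict_of_ae ((hterm k).mono fun t ht =>
              ht.trans_eq (by ring)))
        _ = C₃ * weight (-(2 * M)) k * C₂ * ∫⁻ t in Set.Icc (-T) T, ‖G k t‖ₑ :=
            lintegral_const_mul' _ _ (ENNReal.mul_ne_top (ENNReal.mul_ne_top ENNReal.coe_ne_top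
              (weight_ne_top _ _)) ENNReal.coe_ne_top)
        _ ≤ C₃ * weight (-(2 * M)) k * C₂ * (K * (∫⁻ t, ‖G k t‖ₑ ^ r) ^ (1 / r)) := by
            gcongr
            exact hKle _ (hG k).enorm
        _ = C₃ * C₂ * K * (weight (-(2 * M)) k * (∫⁻ t, ‖G k t‖ₑ ^ r) ^ (1 / r)) := by ring
        _ ≤ C₃ * C₂ * K * (weight (-(2 * n)) k * Λ) := mul_le_mul_right (hwN k) _
        _ = _ := by ring
    refine ((ENNReal.tsum_le_tsum hle).trans_lt ?_).ne
    rw [ENNReal.tsum_mul_left]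
    exact ENNReal.mul_lt_top (ENNReal.mul_lt_top (ENNReal.mul_lt_top (ENNReal.mul_lt_top
      ENNReal.coe_lt_top ENNReal.coe_lt_top) hK.lt_top) hf) tsum_weight_lt_top
  obtain ⟨u, hu, hbox⟩ := hρ.exists_isDuhamel hP hM hFm
    (fun k => (hv k).mono fun t ht => by rw [← ht, Lp.fourier_toTemperedDistribution_eq]) hfin
  refine ⟨u, hu, ?_⟩
  have hle : ∀ k, weight s k * bochnerLebNorm ∞ 2 (fun t => box ρ k (u t)) ≤
      C₁ * (weight σ k * bochnerLebNorm (ENNReal.ofReal r) p' (fun t => box ρ k (f t))) := by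
    intro k
    have hc : Continuous fun t => (𝓕⁻ (duhamel P (fun t => 𝓕 (B k (G k t))) t) : L2 n) :=
      continuous_fourierInv.comp (hbox k).1
    rw [bochnerLebNorm_eq hc.aestronglyMeasurable (ae_of_all _ fun t => ((hbox k).2 t).symm),
      eLpNorm_exponent_top, hN, weight_add, mul_assoc, ← mul_assoc, mul_comm (C₁ : ℝ≥0∞),
      mul_assoc]
    gcongr
    refine eLpNormEssSup_le_of_ae_enorm_bound (ae_of_all _ fun t => ?_)
    rw [← ofReal_norm, ← Lp.norm_fourier_eq, fourier_fourierInv_eq, ofReal_norm]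
    exact hC₁ k f _ (G k) (hG k) (hv k) (hGf k) t
  calc lBoxNorm ρ s q ∞ 2 u
      ≤ (∑' k, (C₁ * (weight σ k *
          bochnerLebNorm (ENNReal.ofReal r) p' (fun t => box ρ k (f t)))) ^ q) ^ (1 / q) := by
        rw [lBoxNorm]
        exact ENNReal.rpow_le_rpow
          (ENNReal.tsum_le_tsum fun k => ENNReal.rpow_le_rpow (hle k) hq.le) (by positivity)
    _ = C₁ * Λ := by
        simp only [ENNReal.mul_rpow_of_nonneg _ _ hq.le]
        rw [ENNReal.tsum_mul_left, ENNReal.mul_rpow_of_nonneg _ _ (by positivity),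
          ← ENNReal.rpow_mul, mul_one_div_cancel hq.ne', ENNReal.rpow_one]
        simp only [Λ, lBoxNorm, ENNReal.mul_rpow_of_nonneg _ _ hq.le]

end InhomogeneousStrichartz

end ModulationSpace

end

/-! ### The theorem -/

theorem mainTheorem12 (n : ℕ) (hn : 0 < n)
    (ρ : ModulationSpace.Euc n → ℝ) (hρ : ModulationSpace.IsGenerator ρ)
    (P : ModulationSpace.Euc n → ℝ) (hP : AEMeasurable P)
    (p p' : ℝ≥0∞) [Fact (1 ≤ p)] [Fact (1 ≤ p')] (hpp' : p.HolderConjugate p')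
    (hp : 2 ≤ p) (hp_top : p < ∞) (q : ℝ) (hq : 1 ≤ q)
    (α δ μ : ℝ) (hμ0 : 0 < μ) (hμ1 : μ < 1)
    (hU : ModulationSpace.DispersiveEstimate ρ P p p' q α δ μ)
    (γ γ' : ℝ) (hγ : γ = 2 / μ) (hγγ' : γ.HolderConjugate γ') (s : ℝ) :
    (∃ C : ℝ≥0, ∀ f : ℝ → 𝓢'(ModulationSpace.Euc n, ℂ),
      ModulationSpace.lBoxNorm ρ (s + δ / 2) q (ENNReal.ofReal γ') p' f < ∞ →
        ∃ u : ℝ → 𝓢'(ModulationSpace.Euc n, ℂ), ModulationSpace.IsDuhamel P f u ∧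
          ModulationSpace.lBoxNorm ρ s q ∞ 2 u ≤
            C * ModulationSpace.lBoxNorm ρ (s + δ / 2) q (ENNReal.ofReal γ') p' f) ∧
    (γ' ≤ q →
      ∃ C : ℝ≥0, ∀ f : ℝ → 𝓢'(ModulationSpace.Euc n, ℂ),
        ModulationSpace.bochnerModNorm ρ (ENNReal.ofReal γ') (s + δ / 2) p' q f < ∞ →
          ∃ u : ℝ → 𝓢'(ModulationSpace.Euc n, ℂ), ModulationSpace.IsDuhamel P f u ∧
            ModulationSpace.bochnerModNorm ρ ∞ s 2 q u ≤
              C * ModulationSpace.bochnerModNorm ρ (ENNReal.ofReal γ') (s + δ / 2) p' q f) := by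
  have hq0 : 0 < q := one_pos.trans_le hq
  have hconj := hpp'.inv_add_inv_eq_one
  -- This is where `p < ∞` enters: the `L^{p'} → L²` bound was proved by Hölder with a finite
  -- conjugate exponent.
  have h1 : 1 < p' := by
    refine lt_of_le_of_ne Fact.out fun h => ?_
    rw [← h, inv_one] at hconj
    have h0 : p⁻¹ = 0 := by
      have : p⁻¹ + 1 = 0 + 1 := by rw [hconj, zero_add]
      exact (ENNReal.add_left_inj ENNReal.one_ne_top).1 this
    exact hp_top.ne (ENNReal.inv_eq_zero.1 h0)
  have h2 : p' ≤ 2 := by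
    rw [← ENNReal.inv_le_inv]
    by_contra! hc
    have h3 : p⁻¹ + p'⁻¹ < 2⁻¹ + 2⁻¹ :=
      ENNReal.add_lt_add_of_le_of_lt (ne_top_of_le_ne_top (by simp) (ENNReal.inv_le_inv.2 hp))
        (ENNReal.inv_le_inv.2 hp) hc
    rw [hconj, ENNReal.inv_two_add_inv_two] at h3
    exact lt_irrefl _ h3
  -- The relation `1/γ' = 1 - μ/2`, which is the exponent condition of the Hardy-Littlewood-Sobolev
  -- inequality.
  have hr : γ' * (2 - μ) = 2 := by
    have h3 := hγγ'.inv_add_inv_eq_one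
    have h4 := hγγ'.symm.pos
    rw [hγ] at h3
    field_simp at h3
    linarith
  obtain ⟨C, hC⟩ := hρ.exists_isDuhamel_lBoxNorm_le hP hpp' h1 h2 hq0 hμ0 hμ1 hU hr s
  refine ⟨⟨C, hC⟩, fun hγq => ⟨C, fun f hf => ?_⟩⟩
  have hle := ModulationSpace.lBoxNorm_le_bochnerModNorm (ρ := ρ) (a := p') (u := f)
    hγγ'.symm.pos hγq (s + δ / 2)
  obtain ⟨u, hu, hule⟩ := hC f (hle.trans_lt hf)
  exact ⟨u, hu, (ModulationSpace.bochnerModNorm_top_le_lBoxNorm hq0 s).trans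
    (hule.trans (mul_le_mul_right hle _))⟩
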